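/- **Setting.** Let $e_3=(0,0,1)^\top$ and let $\mathrm{spin}:S^3\to SO(3)$ send a unit quaternion $q=w+x\mathbf i+y\mathbf j+z\mathbf k$ to the rotation $v\mapsto qv\bar q$ of $\mathbb R^3=\mathrm{Im}\,\mathbb H$. For $\eta=(a,b,c)\in S^2\setminus\{-e_3\}$ put $s(\eta)=\frac1{\sqrt{2(1+c)}}(1+c,-b,a,0)\in S^3$, and let $H(\eta,\varphi)=\mathrm{spin}(s(\eta))\circ R_{e_3}(\varphi)$ for $\varphi\in S^1=\mathbb R/2\pi\mathbb Z$, where $R_{e_3}(\varphi)$ is the rotation by $\varphi$ about $e_3$. Conversely, for $\omega\in SO(3)$ with $\omega e_3\ne -e_3$ let $\ell^\star(\omega)=(\eta,\varphi)$ where $\eta=\omega e_3$ and $\varphi$ is the angle with $\omega=H(\eta,\varphi)$. Let $\xi(\mathbf t,\omega)=(\mathbf t,\ell^\star(\omega))$, a map from $A=\mathbb R^3\times SO(3)$ to $B=\mathbb R^3\times S^2\times S^1$ defined for $\omega e_3\neq -e_3$, and let $\ell$ be the map on $A\sqcup B$ that is $\xi$ on $A$ and $\xi^{-1}(\mathbf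 t,\eta,\varphi)=(\mathbf t,H(\eta,\varphi))$ on $B$ (for $\eta\ne -e_3$). Likewise $\ell^\star$ also denotes the map on $SO(3)\sqcup (S^2\times S^1)$ given by $\ell^\star$ and $H$. For rigid motions $g_1,g_2\in SE(3)=\mathbb R^3\rtimes SO(3)$ let $\ell^\circ$ be the map on $A\sqcup B$ given by $x\mapsto\xi(g_1^{-1}xg_2^{-1})$ on $A$ and $y\mapsto g_1\,\xi^{-1}(y)\,g_2$ on $B$. Let $\nu$ be the sum of Lebesgue $\times$ Haar measure on $A$ and Lebesgue $\times$ uniform $\times$ uniform measure on $B$, where $SO(3),S^2,S^1$ have total masses $m_0,m_2,m_1>0$; let $\nu^\star$ be its orientation part, on $SO(3)\sqcup(S^2\times S^1)$. **(1) Hopf coordinates.** For $\eta\ne -e_3$, $s(\eta)$ is the unique unit quaternion $q$ with $\mathrm{spin}(q)e_3=\eta$ that has minimal geodesic distance to $1$ in $S^3$. If $\omega=\mathrm{spin}(w,x,y,z)$ and $\omega e_3\neq -e_3$, then $\ell^\star(\omega)=(\eta,\varphi)$ with $$\eta=\bigl(2(xz+wy),\,2(yz-wx),\,1-2(x^2+y^2)\bigr),\qquad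 \varphi=2\arctan(z/w),$$ with $\arctan$ valued in $[0,\pi)$ and $\arctan(\pm\infty)=\pi/2$. For $\eta=(a,b,c)\neq -e_3$, $$H(\eta,\varphi)=\mathrm{spin}\Bigl(\tfrac1{\sqrt{2(1+c)}}\bigl((1+c)\cos\tfrac\varphi2,\ a\sin\tfrac\varphi2-b\cos\tfrac\varphi2,\ a\cos\tfrac\varphi2+b\sin\tfrac\varphi2,\ (1+c)\sin\tfrac\varphi2\bigr)\Bigr).$$ **(2) Diffeomorphism off a null set.** $\ell^\star$ is a diffeomorphism from $\{\omega:\omega e_3\ne -e_3\}$ onto $(S^2\setminus\{-e_3\})\times S^1$ with inverse $H$; it restricts to a diffeomorphism from $A^\star=\{\mathrm{spin}(w,x,y,z):z\ne0\}$ onto $B^\star=\{(\eta,\varphi):\eta\neq -e_3,\ \varphi\ne0\}$; and $\xi$ is a diffeomorphism from $\{(\mathbf t,\omega):\omega e_3\neq -e_3\}$ onto $\{(\mathbf t,\eta,\varphi):\eta\ne -e_3\}$ with inverse $\xi^{-1}$. All these sets have complements of measure zero. In particular $\ell$ is defined $\nu$-a.e. **(3) Density.** $\nu\circ\ell^{-1}\ll\nu$,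 and $\frac{d(\nu\circ\ell^{-1})}{d\nu}$ equals $m_2m_1/m_0$ a.e. on $A$ and $m_0/(m_2m_1)$ a.e. on $B$. The same holds for $\ell^\circ$, for all $g_1,g_2$, and (with $\nu^\star$, on $SO(3)$ and on $S^2\times S^1$) for $\ell^\star$. If $m_0=\pi^2$, $m_2=4\pi$, $m_1=2\pi$, the two values for $\ell$ are $8$ and $1/8$. **(4) Moves on scene graphs.** Let $V=\{r,v_1,\dots,v_N\}$, let $F$ be a finite set of faces, and for each object $v\neq r$ and $f\in F$ let a pose $\mathrm{face}(v,f)\in SE(3)$ of the face $f$ relative to $v$ be given. A latent state is $(G,\theta)$ with $G$ a directed tree on $V$ rooted at $r$, $\theta_v\in SE(3)$ if the parent of $v$ is $r$ ($v$ is floating), and $\theta_v=(f,f',y)\in F\times F\times B$ otherwise ($v$ is in contact). The absolute pose is $\mathbf x_v=\theta_v$ for floating $v$ and $\mathbf x_v=\mathbf x_u\,\mathrm{face}(u,f')\,\xi^{-1}(y)\,\mathrm{face}(v,f)^{-1}$ for $v$ in contact with parent $u$. An extended state is a latent state with either a pair $(v,r)$, or a tuple $(v,u,f,f')$ with objects $v,u$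 such that $u$ is neither $v$ nor a descendant of $v$, and $f,f'\in F$. Let $\mu$ be the base measure on extended states, built from counting measures and the above measures with $m_0=\pi^2$, $m_2=4\pi$, $m_1=2\pi$. The move $h$ replaces the edge from the parent $u'$ of $v$ to $v$ by the edge from $u$ (or $r$) to $v$ and keeps $\theta_w$ for $w\ne v$. The new $\theta_v$ is $\mathbf x_v$ if the target is $r$, and $(f,f',\xi((\mathbf x_u\,\mathrm{face}(u,f'))^{-1}\mathbf x_v\,\mathrm{face}(v,f)))$ if the target is $(u,f,f')$. The new auxiliary variable is $(v,r)$ if $u'=r$ and $(v,u',f_2,f_2')$ if $\theta_v$ was $(f_2,f_2',\cdot)$. Then $\mu\circ h^{-1}\ll\mu$, and for $\mu$-almost every extended state $\frac{d(\mu\circ h^{-1})}{d\mu}$ equals $8$ if $v$ is floating and the target is an object (floating to contact), $1/8$ if $v$ is in contact and the target is $r$ (contact to floating), and $1$ otherwise. Consequently, let $p(x)=(N+1)^{-(N-1)}\,\mathrm{prior}(x)\,\mathrm{lik}(x)$ (a uniform prior on trees), let $q(y;x)$ be the auxiliary density, and write $h(x,y)=(x',y')$. The involutive MCMC acceptance probability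 $\min\{1,\frac{p(x')q(y';x')}{p(x)q(y;x)}\frac{d(\mu\circ h^{-1})}{d\mu}(x,y)\}$ is, for $\mu$-a.e. $(x,y)$ with $p(x)q(y;x)>0$, equal to $1$ for floating-to-floating moves and otherwise to $$\min\Bigl\{1,\ \tfrac{\mathrm{lik}(x')}{\mathrm{lik}(x)}\,\tfrac{\mathrm{prior}(x')}{\mathrm{prior}(x)}\,\tfrac{q(y';x')}{q(y;x)}\,\kappa\Bigr\}$$ with $\kappa=8$ (floating to contact), $\kappa=1/8$ (contact to floating), $\kappa=1$ (contact to contact). -/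

import Mathlib

open MeasureTheory Quaternion Set
open scoped ENNReal

noncomputable section

namespace ScenePose

/-! ### Spaces of orientations -/

/-- Euclidean three-space. -/
abbrev E3 := EuclideanSpace ℝ (Fin 3)

/-- The rotation group `SO(3)`. -/
abbrev SO3 := Matrix.specialOrthogonalGroup (Fin 3) ℝ

/-- The unit sphere `S²` in three-space. -/
abbrev S2 := Metric.sphere (0 : E3) 1

/-- The unit circle `S¹`, the angle `φ` being the point `exp (i φ)` of the complex plane. -/
abbrev S1 := Metric.sphere (0 : ℂ) 1

/-- The unit quaternions `S³`. -/
abbrev S3 := Metric.sphere (0 : ℍ[ℝ]) 1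

theorem mem_SO3_iff {M : Matrix (Fin 3) (Fin 3) ℝ} :
    M ∈ Matrix.specialOrthogonalGroup (Fin 3) ℝ ↔ M * M.transpose = 1 ∧ M.det = 1 := by
  rw [Matrix.mem_specialOrthogonalGroup_iff, Matrix.mem_orthogonalGroup_iff]

theorem coe_inv_SO3 (R : SO3) : ((R⁻¹ : SO3) : Matrix (Fin 3) (Fin 3) ℝ) = R.1.transpose := rfl

instance : IsTopologicalGroup SO3 where
  continuous_mul := continuous_mul
  continuous_inv := by
    refine Continuous.subtype_mk (f := fun R : SO3 => R.1.transpose) ?_ fun R => (R⁻¹).2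
    exact continuous_subtype_val.matrix_transpose

instance : CompactSpace SO3 := by
  suffices h : IsCompact (Matrix.specialOrthogonalGroup (Fin 3) ℝ : Set (Matrix (Fin 3) (Fin 3) ℝ))
    from isCompact_iff_compactSpace.1 h
  have hK : IsCompact (Set.pi univ fun _ : Fin 3 => Set.pi univ fun _ : Fin 3 => Icc (-1 : ℝ) 1) :=
    isCompact_univ_pi fun _ => isCompact_univ_pi fun _ => isCompact_Icc
  refine IsCompact.of_isClosed_subset (X := Matrix (Fin 3) (Fin 3) ℝ) hK ?_ ?_
  · have : ((Matrix.specialOrthogonalGroup (Fin 3) ℝ : Set (Matrix (Fin 3) (Fin 3) ℝ)))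
        = {M | M * M.transpose = 1} ∩ {M | M.det = 1} := by
      ext M; exact mem_SO3_iff
    rw [this]
    exact (isClosed_eq (continuous_id.matrix_mul continuous_id.matrix_transpose)
      continuous_const).inter (isClosed_eq continuous_id.matrix_det continuous_const)
  · intro M hM i _ j _
    have h := congrFun (congrFun (mem_SO3_iff.1 hM).1 i) i
    rw [Matrix.mul_apply, Matrix.one_apply_eq] at h
    simp only [Matrix.transpose_apply] at h
    have h2 : M i j * M i j ≤ ∑ k, M i k * M i k :=
      Finset.single_le_sum (f := fun k => M i k * M i k) (fun k _ => mul_self_nonneg _)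
        (Finset.mem_univ j)
    rw [h] at h2
    exact ⟨by nlinarith, by nlinarith⟩

instance : MeasurableSpace SO3 := borel SO3

instance : BorelSpace SO3 := ⟨rfl⟩

/-- The action of a rotation on a vector. -/
def act (R : SO3) (t : E3) : E3 := WithLp.toLp 2 (R.1.mulVec t.ofLp)

theorem norm_act (R : SO3) (t : E3) : ‖act R t‖ = ‖t‖ := by
  have hR : R.1.transpose * R.1 = 1 := mul_eq_one_comm.1 (mem_SO3_iff.1 R.2).1
  have h : R.1.mulVec t.ofLp ⬝ᵥ R.1.mulVec t.ofLp = t.ofLp ⬝ᵥ t.ofLp := by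
    rw [Matrix.dotProduct_mulVec, Matrix.vecMul_mulVec, hR, Matrix.vecMul_one]
  rw [EuclideanSpace.norm_eq, EuclideanSpace.norm_eq]
  congr 1
  simpa [act, dotProduct, pow_two] using h

/-- The north pole `(0, 0, 1)`. -/
def north : S2 := ⟨!₂[0, 0, 1], by simp [EuclideanSpace.norm_eq, Fin.sum_univ_three]⟩

/-- The south pole `(0, 0, -1)`. -/
def south : S2 := ⟨!₂[0, 0, -1], by simp [EuclideanSpace.norm_eq, Fin.sum_univ_three]⟩

/-- The image `R (0, 0, 1)` of the north pole. -/
def poleImage (R : SO3) : S2 :=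
  ⟨act R north, by simpa using (norm_act R north).trans (by simp)⟩

/-! ### The double covering `S³ → SO(3)` -/

/-- The quaternion `w + x i + y j + z k`. -/
def quat (w x y z : ℝ) : ℍ[ℝ] := ⟨w, x, y, z⟩

/-- The three coordinates of the imaginary part of a quaternion. -/
def imCoord (q : ℍ[ℝ]) : Fin 3 → ℝ := ![q.imI, q.imJ, q.imK]

/-- The imaginary units `i, j, k`. -/
def imUnit : Fin 3 → ℍ[ℝ] := ![quat 0 1 0 0, quat 0 0 1 0, quat 0 0 0 1]

/-- The matrix of `v ↦ q v q*` on imaginary quaternions. -/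
def spinMatrix (q : ℍ[ℝ]) : Matrix (Fin 3) (Fin 3) ℝ :=
  Matrix.of fun i j => imCoord (q * imUnit j * star q) i

theorem S3_sq (q : S3) : q.1.re ^ 2 + q.1.imI ^ 2 + q.1.imJ ^ 2 + q.1.imK ^ 2 = 1 := by
  have h : ‖q.1‖ = 1 := by simp
  rw [← Quaternion.normSq_def', Quaternion.normSq_eq_norm_mul_self, h, one_mul]

theorem spinMatrix_eq (q : ℍ[ℝ]) : spinMatrix q =
    !![q.re ^ 2 + q.imI ^ 2 - q.imJ ^ 2 - q.imK ^ 2, 2 * (q.imI * q.imJ - q.re * q.imK),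
        2 * (q.imI * q.imK + q.re * q.imJ);
      2 * (q.imI * q.imJ + q.re * q.imK), q.re ^ 2 - q.imI ^ 2 + q.imJ ^ 2 - q.imK ^ 2,
        2 * (q.imJ * q.imK - q.re * q.imI);
      2 * (q.imI * q.imK - q.re * q.imJ), 2 * (q.imJ * q.imK + q.re * q.imI),
        q.re ^ 2 - q.imI ^ 2 - q.imJ ^ 2 + q.imK ^ 2] := by
  ext i j
  fin_cases i <;> fin_cases j <;>
    simp [spinMatrix, imCoord, imUnit, quat] <;> ring

/-- The covering map from unit quaternions to rotations. -/
def spin (q : S3) : SO3 := ⟨spinMatrix q, by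
  have h := S3_sq q
  rw [mem_SO3_iff, spinMatrix_eq]
  generalize q.1.re = w at h ⊢
  generalize q.1.imI = x at h ⊢
  generalize q.1.imJ = y at h ⊢
  generalize q.1.imK = z at h ⊢
  have h2 : (w ^ 2 + x ^ 2 + y ^ 2 + z ^ 2) ^ 2 = 1 := by rw [h]; norm_num
  have h3 : (w ^ 2 + x ^ 2 + y ^ 2 + z ^ 2) ^ 3 = 1 := by rw [h]; norm_num
  constructor
  · ext i j
    fin_cases i <;> fin_cases j <;>
      simp [Matrix.mul_apply, Fin.sum_univ_three] <;> first | linear_combination h2 | ring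
  · rw [Matrix.det_fin_three]
    simp
    linear_combination h3⟩

/-- Rotation about the vertical axis by the angle `φ`. -/
def rotZ (φ : S1) : SO3 :=
  ⟨!![φ.1.re, -φ.1.im, 0; φ.1.im, φ.1.re, 0; 0, 0, 1], by
    have h : φ.1.re ^ 2 + φ.1.im ^ 2 = 1 := by
      have h1 : ‖φ.1‖ = 1 := by simp
      have h2 := Complex.sq_norm φ.1
      rw [h1, Complex.normSq_apply] at h2
      linarith
    rw [mem_SO3_iff]
    constructor
    · ext i j
      fin_cases i <;> fin_cases j <;> simp [Matrix.mul_apply, Fin.sum_univ_three] <;>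
        linarith
    · rw [Matrix.det_fin_three]
      simp
      linarith⟩

/-! ### Hopf coordinates -/

theorem S2_sq (η : S2) : η.1 0 ^ 2 + η.1 1 ^ 2 + η.1 2 ^ 2 = 1 := by
  have h : ‖η.1‖ = 1 := by simp
  rw [EuclideanSpace.norm_eq, Real.sqrt_eq_one, Fin.sum_univ_three] at h
  simpa using h

/-- The unit quaternion `((1 + c), -b, a, 0) / √(2 (1 + c))` for `η = (a, b, c)` other than the
south pole, where the value `1` is a placeholder. -/
def hopfQuat (η : S2) : S3 :=
  if h : η.1 2 = -1 then ⟨1, by simp⟩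
  else ⟨quat ((1 + η.1 2) / √(2 * (1 + η.1 2))) (-η.1 1 / √(2 * (1 + η.1 2)))
      (η.1 0 / √(2 * (1 + η.1 2))) 0, by
    have h1 := S2_sq η
    have hc : 0 < 1 + η.1 2 := by
      have : -1 ≤ η.1 2 := by nlinarith [sq_nonneg (η.1 0), sq_nonneg (η.1 1)]
      rcases this.lt_or_eq with h2 | h2
      · linarith
      · exact absurd h2.symm h
    have hs : √(2 * (1 + η.1 2)) ^ 2 = 2 * (1 + η.1 2) := Real.sq_sqrt (by linarith)
    rw [mem_sphere_zero_iff_norm, ← sq_eq_sq₀ (norm_nonneg _) zero_le_one, pow_two,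
      ← Quaternion.normSq_eq_norm_mul_self, Quaternion.normSq_def']
    simp only [quat, div_pow, hs]
    field_simp
    linarith⟩

/-- The rotation with Hopf coordinates `(η, φ)`: a turn by `φ` about the vertical axis, followed by
the chosen rotation that carries the north pole to `η`. -/
def hopfRot (p : S2 × S1) : SO3 := spin (hopfQuat p.1) * rotZ p.2

open Classical in
/-- The Hopf coordinates of a rotation `R`: the first one is `η = R (0, 0, 1)`, the second one is
the `φ` with `R = hopfRot (η, φ)`. Where there is no such `φ` (this happens if `η` is the south
pole) it has the placeholder value `1`. -/
def hopfCoord (R : SO3) : S2 × S1 :=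
  (poleImage R, if h : ∃ φ : S1, R = hopfRot (poleImage R, φ) then h.choose else 1)

/-- The orientations `R` with `R (0, 0, 1) ≠ (0, 0, -1)`. -/
def rotDomain : Set SO3 := {R | poleImage R ≠ south}

/-- The pairs `(η, φ)` with `η ≠ (0, 0, -1)`. -/
def hopfDomain : Set (S2 × S1) := {p | p.1 ≠ south}

/-- The rotations `spin (w, x, y, z)` with `z ≠ 0`. -/
def rotStar : Set SO3 := spin '' {q | q.1.imK ≠ 0}

/-- The pairs `(η, φ)` with `η ≠ (0, 0, -1)` and `φ` not on the branch cut. -/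
def hopfStar : Set (S2 × S1) := {p | p.1 ≠ south ∧ p.2 ≠ 1}

/-- The arctangent of `z / w` with values in `[0, π)`, equal to `π / 2` for `w = 0`. -/
def arctanQuot (z w : ℝ) : ℝ :=
  if w = 0 then Real.pi / 2
  else if 0 ≤ z / w then Real.arctan (z / w) else Real.arctan (z / w) + Real.pi

/-! ### Poses and contact parameters -/

/-- Rigid motions `(t, R)` of three-space, `x ↦ R x + t`. -/
abbrev SE3 := E3 × SO3

/-- Contact parameters `((a, b, z), (η, φ))`. -/
abbrev Contact := (ℝ × ℝ × ℝ) × (S2 × S1)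

/-- Composition of rigid motions. -/
def SE3.comp (x y : SE3) : SE3 := (x.1 + act x.2 y.1, x.2 * y.2)

/-- The inverse rigid motion. -/
def SE3.inv (x : SE3) : SE3 := (-act x.2⁻¹ x.1, x.2⁻¹)

/-- The identity motion. -/
def SE3.id : SE3 := (0, 1)

/-- From relative poses to contact parameters: the translation is copied and the rotation is
expressed in Hopf coordinates. -/
def xi (x : SE3) : Contact := ((x.1 0, x.1 1, x.1 2), hopfCoord x.2)

/-- From contact parameters to relative poses. -/
def xiInv (y : Contact) : SE3 := (!₂[y.1.1, y.1.2.1, y.1.2.2], hopfRot y.2)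

/-- The domain of `xi`. -/
def poseDomain : Set SE3 := {x | x.2 ∈ rotDomain}

/-- The domain of `xiInv`. -/
def contactDomain : Set Contact := {y | y.2 ∈ hopfDomain}

/-- The conversion between relative poses and contact parameters, in both directions. -/
def ell : SE3 ⊕ Contact → SE3 ⊕ Contact :=
  Sum.elim (fun x => Sum.inr (xi x)) (fun y => Sum.inl (xiInv y))

/-- The conversion between absolute poses and contact parameters: the absolute pose is
`g₁ x g₂` where `x` is the relative pose. -/
def ellAbs (g₁ g₂ : SE3) : SE3 ⊕ Contact → SE3 ⊕ Contact :=
  Sum.elim (fun x => Sum.inr (xi ((g₁.inv.comp x).comp g₂.inv)))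
    (fun y => Sum.inl ((g₁.comp (xiInv y)).comp g₂))

/-- The orientation part of `ell`. -/
def ellStar : SO3 ⊕ (S2 × S1) → SO3 ⊕ (S2 × S1) :=
  Sum.elim (fun R => Sum.inr (hopfCoord R)) (fun p => Sum.inl (hopfRot p))

/-- The domain of `ell`. -/
def ellDomain : Set (SE3 ⊕ Contact) := Sum.inl '' poseDomain ∪ Sum.inr '' contactDomain

/-! ### Smooth maps between subsets of Euclidean spaces -/

/-- `f`, a map between the spaces `X` and `Y` embedded in normed spaces by `i` and `j`, is smooth on
`S`: near each point of `S` it is the restriction of a smooth map between the normed spaces. -/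
def SmoothOnVia {X Y E F : Type*} [NormedAddCommGroup E] [NormedSpace ℝ E]
    [NormedAddCommGroup F] [NormedSpace ℝ F] (i : X → E) (j : Y → F) (f : X → Y) (S : Set X) :
    Prop :=
  ∀ x ∈ S, ∃ U : Set E, IsOpen U ∧ i x ∈ U ∧ ∃ Φ : E → F,
    ContDiffOn ℝ ((⊤ : ℕ∞) : WithTop ℕ∞) Φ U ∧ ∀ x' ∈ S, i x' ∈ U → Φ (i x') = j (f x')

/-- `f` restricts to a diffeomorphism from `S` onto `T` whose inverse is the restriction of `g`. -/
def IsDiffeoOnVia {X Y E F : Type*} [NormedAddCommGroup E] [NormedSpace ℝ E]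
    [NormedAddCommGroup F] [NormedSpace ℝ F] (i : X → E) (j : Y → F) (f : X → Y) (g : Y → X)
    (S : Set X) (T : Set Y) : Prop :=
  MapsTo f S T ∧ MapsTo g T S ∧ InvOn g f S T ∧ SmoothOnVia i j f S ∧ SmoothOnVia j i g T

/-- The embedding of `SO(3)` in the space of matrices. -/
def embRot (R : SO3) : Fin 3 → Fin 3 → ℝ := fun i j => R.1 i j

/-- The embedding of `S² × S¹` in `ℝ³ × ℂ`. -/
def embHopf (p : S2 × S1) : E3 × ℂ := (p.1, p.2)

/-- The embedding of the space of poses. -/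
def embPose (x : SE3) : E3 × (Fin 3 → Fin 3 → ℝ) := (x.1, embRot x.2)

/-- The embedding of the space of contact parameters. -/
def embContact (y : Contact) : (ℝ × ℝ × ℝ) × (E3 × ℂ) := (y.1, embHopf y.2)

/-! ### Base measures -/

/-- Haar measure on `SO(3)` with total mass `m`. -/
def haarSO3 (m : ℝ) : Measure SO3 :=
  (ENNReal.ofReal m / (Measure.haar : Measure SO3) univ) • Measure.haar

/-- The uniform measure on `S²` with total mass `m`. -/
def uniformS2 (m : ℝ) : Measure S2 :=
  (ENNReal.ofReal m / (volume : Measure E3).toSphere univ) • (volume : Measure E3).toSphere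

/-- The uniform measure on `S¹` with total mass `m`. -/
def uniformS1 (m : ℝ) : Measure S1 :=
  (ENNReal.ofReal m / (volume : Measure ℂ).toSphere univ) • (volume : Measure ℂ).toSphere

/-- The measure on a disjoint union with given restrictions to the two parts. -/
def sumMeasure {X Y : Type*} [MeasurableSpace X] [MeasurableSpace Y] (μ : Measure X)
    (ν : Measure Y) : Measure (X ⊕ Y) :=
  μ.map Sum.inl + ν.map Sum.inr

/-- The base measure on poses; `m₀` is the mass of `SO(3)`. -/
def poseMeasure (m₀ : ℝ) : Measure SE3 := (volume : Measure E3).prod (haarSO3 m₀)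

/-- The base measure on `S² × S¹`; `m₂` and `m₁` are the masses of `S²` and `S¹`. -/
def hopfMeasure (m₂ m₁ : ℝ) : Measure (S2 × S1) := (uniformS2 m₂).prod (uniformS1 m₁)

/-- The base measure on contact parameters. -/
def contactMeasure (m₂ m₁ : ℝ) : Measure Contact :=
  (volume : Measure (ℝ × ℝ × ℝ)).prod (hopfMeasure m₂ m₁)

/-- The base measure on the disjoint union of poses and contact parameters. -/
def baseMeasure (m₀ m₂ m₁ : ℝ) : Measure (SE3 ⊕ Contact) :=
  sumMeasure (poseMeasure m₀) (contactMeasure m₂ m₁)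

/-- The orientation part of the base measure. -/
def baseMeasureStar (m₀ m₂ m₁ : ℝ) : Measure (SO3 ⊕ (S2 × S1)) :=
  sumMeasure (haarSO3 m₀) (hopfMeasure m₂ m₁)

/-! ### Scene graphs -/

/-- Directed trees on a root and `N` objects, rooted at the root, given by the parents of the
objects; `none` stands for the root. -/
structure RootedTree (N : ℕ) where
  /-- The parent of an object. -/
  par : Fin N → Option (Fin N)
  /-- Going up from parent to parent ends at the root. -/
  wf : WellFounded fun u v => par v = some u

instance (N : ℕ) : MeasurableSpace (RootedTree N) := ⊤

/-- The object `w` belongs to the subtree of `v`: it is `v` or a descendant of `v`. -/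
def RootedTree.InSubtree {N : ℕ} (G : RootedTree N) (v w : Fin N) : Prop :=
  Relation.ReflTransGen (fun a b => G.par b = some a) v w

open Classical in
/-- Sever `v` from its parent and graft it onto `p`, if this gives a tree. -/
def RootedTree.regraft {N : ℕ} (G : RootedTree N) (v : Fin N) (p : Option (Fin N)) :
    RootedTree N :=
  if h : WellFounded fun u w => Function.update G.par v p w = some u then
    ⟨Function.update G.par v p, h⟩
  else G

/-- The parameter of one object: a pose, for children of the root, or `(f, f', contact parameters)`
with a face `f` of the object and a face `f'` of its parent. -/
abbrev Param (K : ℕ) := SE3 ⊕ (Fin K × Fin K × Contact)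

/-- Pairs of a tree and parameters for all objects. -/
abbrev Latent (N K : ℕ) := RootedTree N × (Fin N → Param K)

/-- Auxiliary variables: `(v, root)` or `(v, u, f, f')`. -/
abbrev Aux (N K : ℕ) := Fin N ⊕ (Fin N × Fin N × Fin K × Fin K)

/-- Parameters that have the form prescribed by the tree. -/
def latentSpace (N K : ℕ) : Set (Latent N K) :=
  {x | ∀ v, (x.2 v).isLeft = true ↔ x.1.par v = none}

/-- The admissible auxiliary variables: the graft vertex is not in the severed subtree. -/
def auxSpace {N : ℕ} (K : ℕ) (G : RootedTree N) : Set (Aux N K) :=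
  {y | ∀ v u f f', y = Sum.inr (v, u, f, f') → ¬ G.InSubtree v u}

/-- The extended state space. -/
def stateSpace (N K : ℕ) : Set (Latent N K × Aux N K) :=
  {s | s.1 ∈ latentSpace N K ∧ s.2 ∈ auxSpace K s.1.1}

/-- States with a floating object `v` and target the root. -/
def floatingToFloating (N K : ℕ) : Set (Latent N K × Aux N K) :=
  {s ∈ stateSpace N K | ∃ v, s.2 = Sum.inl v ∧ s.1.1.par v = none}

/-- States with an object `v` in contact and target the root. -/
def contactToFloating (N K : ℕ) : Set (Latent N K × Aux N K) :=
  {s ∈ stateSpace N K | ∃ v, s.2 = Sum.inl v ∧ s.1.1.par v ≠ none}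

/-- States with a floating object `v` and target a face of an object. -/
def floatingToContact (N K : ℕ) : Set (Latent N K × Aux N K) :=
  {s ∈ stateSpace N K | ∃ v u f f', s.2 = Sum.inr (v, u, f, f') ∧ s.1.1.par v = none}

/-- States with an object `v` in contact and target a face of an object. -/
def contactToContact (N K : ℕ) : Set (Latent N K × Aux N K) :=
  {s ∈ stateSpace N K | ∃ v u f f', s.2 = Sum.inr (v, u, f, f') ∧ s.1.1.par v ≠ none}

/-- The absolute poses of the objects; `face v f` is the pose of the face `f` of the object `v`
relative to `v`. Parameters of the wrong form give the placeholder pose `SE3.id`. -/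
def absPose {N K : ℕ} (face : Fin N → Fin K → SE3) (x : Latent N K) : Fin N → SE3 :=
  x.1.wf.fix fun v pose =>
    match h : x.1.par v, x.2 v with
    | none, Sum.inl p => p
    | some u, Sum.inr (f, f', y) =>
        (((pose u h).comp (face u f')).comp (xiInv y)).comp (face v f).inv
    | _, _ => SE3.id

/-- The pose of the face `f` of `v` relative to the face `f'` of `u`. -/
def relPose {N K : ℕ} (face : Fin N → Fin K → SE3) (x : Latent N K) (u : Fin N) (f' : Fin K)
    (v : Fin N) (f : Fin K) : SE3 :=
  ((absPose face x u).comp (face u f')).inv.comp ((absPose face x v).comp (face v f))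

/-- The involution on extended states. States that have no parameters of the right form are
left unchanged. -/
def move {N K : ℕ} (face : Fin N → Fin K → SE3) (s : Latent N K × Aux N K) :
    Latent N K × Aux N K :=
  match s.2 with
  | Sum.inl v =>
    match s.1.1.par v, s.1.2 v with
    | some u', Sum.inr (f, f', _) =>
        ((s.1.1.regraft v none, Function.update s.1.2 v (Sum.inl (absPose face s.1 v))),
          Sum.inr (v, u', f, f'))
    | _, _ => s
  | Sum.inr (v, u, f, f') =>
    match s.1.1.par v, s.1.2 v with
    | none, Sum.inl _ =>
        ((s.1.1.regraft v (some u),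
          Function.update s.1.2 v (Sum.inr (f, f', xi (relPose face s.1 u f' v f)))),
          Sum.inl v)
    | some u', Sum.inr (f₂, f₂', _) =>
        ((s.1.1.regraft v (some u),
          Function.update s.1.2 v (Sum.inr (f, f', xi (relPose face s.1 u f' v f)))),
          Sum.inr (v, u', f₂, f₂'))
    | _, _ => s

/-- The base measure on the parameters of one object. -/
def paramMeasure (K : ℕ) (m₀ m₂ m₁ : ℝ) : Measure (Param K) :=
  sumMeasure (poseMeasure m₀) (Measure.count.prod (Measure.count.prod (contactMeasure m₂ m₁)))

/-- The base measure on the extended state space. -/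
def stateMeasure (N K : ℕ) (m₀ m₂ m₁ : ℝ) : Measure (Latent N K × Aux N K) :=
  (((Measure.count : Measure (RootedTree N)).prod
    (Measure.pi fun _ : Fin N => paramMeasure K m₀ m₂ m₁)).prod Measure.count).restrict
      (stateSpace N K)

/-- The acceptance probability of involutive Markov chain Monte Carlo for the target density `p`,
the auxiliary density `q x y` of `y` given `x`, the involution `h` and the base measure `μ`. -/
def acceptProb {X Y : Type*} [MeasurableSpace X] [MeasurableSpace Y] (μ : Measure (X × Y))
    (h : X × Y → X × Y) (p : X → ℝ) (q : X → Y → ℝ) (s : X × Y) : ℝ :=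
  min 1 (p (h s).1 * q (h s).1 (h s).2 / (p s.1 * q s.1 s.2) * ((μ.map h).rnDeriv μ s).toReal)

end ScenePose

end

open ScenePose

namespace ScenePose

/-! ### Algebra of the Hopf coordinates -/

/-! Geometry. The fibre of `poleImage ∘ spin` over `η` is a Hopf circle, and on it `w ^ 2 + z ^ 2 =
(1 + c) / 2` is constant. Hence the real part, and with it the closeness to `1`, is largest exactly
where `z = 0` and `w > 0`, which is `hopfQuat η`. A rotation `R` with `R e₃ = η ≠ -e₃` differs from
`spin (hopfQuat η)` on the right by a rotation fixing `e₃`, so `R = hopfRot (η, φ)` for some `φ`.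
The matrix of `hopfRot (η, φ)` is polynomial in the coordinates and `1 / (1 + c)`, and `φ` is
recovered from the matrix by a rational formula with denominator `1 + c`. Both formulas make sense
on open sets of the ambient spaces, which gives smoothness in both directions.

Density. No Jacobian is computed. In Hopf coordinates left translation by `g` is a skew product: `η`
is rotated by `g`, and `φ` is multiplied by a unit complex number depending on `η` only. Rotations
preserve the uniform measures on `S²` and `S¹`, so the image under `hopfRot` of their product is
left invariant (`isMulLeftInvariant_map_hopfRot`). By uniqueness of Haar measure it is a multiple of
it, and comparing total masses gives the factor `m₂ * m₁ / m₀` (`measurePreserving_hopfRot`). The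
inverse map scales by the reciprocal, Lebesgue measure is carried along as a factor, and the measure
on poses is invariant under rigid motions on both sides.

Scene graphs. The state space is a finite disjoint union of cells, indexed by `Graft`: a tree, an
object `v`, its present place and its target place. On a cell the move changes one continuous
coordinate, `θ_v`, passing from the old parameters to the absolute pose and on to the new
parameters. The poses of the old and the new parent do not depend on `θ_v`, because neither parent
is in the subtree of `v`. So for fixed other coordinates the passage scales measure by a constant,
and Fubini (`pi_map_update`) gives the same constant on the whole cell (`map_move_cell`). The move
carries the cell of `τ` to the cell of `τ.rev`, and reversal is an involution. Therefore the density
on the cell of `τ` is the constant that belongs to `τ.rev` (`map_move`). -/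

theorem poleImage_apply (R : SO3) (i : Fin 3) : (poleImage R).1 i = R.1 i 2 := by
  simp [poleImage, act, north, Matrix.mulVec, dotProduct, Fin.sum_univ_three]

theorem S2_ext {η ζ : S2} (h : ∀ i, η.1 i = ζ.1 i) : η = ζ :=
  Subtype.ext (PiLp.ext h)

theorem SO3_ext {R S : SO3} (h : ∀ i j, R.1 i j = S.1 i j) : R = S :=
  Subtype.ext (Matrix.ext h)

theorem neg_one_le_height (η : S2) : -1 ≤ η.1 2 := by
  have := S2_sq η
  nlinarith [sq_nonneg (η.1 0), sq_nonneg (η.1 1)]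

theorem eq_south_iff (η : S2) : η = south ↔ η.1 2 = -1 := by
  constructor
  · rintro rfl; simp [south]
  · intro h
    have h1 := S2_sq η
    rw [h] at h1
    have h0 : η.1 0 = 0 := by nlinarith [sq_nonneg (η.1 0), sq_nonneg (η.1 1)]
    have h0' : η.1 1 = 0 := by nlinarith [sq_nonneg (η.1 0), sq_nonneg (η.1 1)]
    refine S2_ext fun i => ?_
    fin_cases i <;> simp [south, h0, h0', h]

theorem one_add_height_pos {η : S2} (h : η ≠ south) : 0 < 1 + η.1 2 := by
  have h1 := neg_one_le_height η
  rcases h1.lt_or_eq with h2 | h2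
  · linarith
  · exact absurd ((eq_south_iff η).2 h2.symm) h

theorem spin_coe (q : S3) : (spin q).1 = spinMatrix q := rfl

theorem spinMatrix_mul (p q : ℍ[ℝ]) : spinMatrix (p * q) = spinMatrix p * spinMatrix q := by
  rw [spinMatrix_eq, spinMatrix_eq, spinMatrix_eq]
  ext i j
  fin_cases i <;> fin_cases j <;>
    simp [Matrix.mul_apply, Fin.sum_univ_three] <;> ring

theorem spin_mul (p q : S3) : spin (p * q) = spin p * spin q :=
  Subtype.ext (spinMatrix_mul p.1 q.1)

theorem rotZ_mul (φ ψ : S1) : rotZ (φ * ψ) = rotZ φ * rotZ ψ := by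
  refine Subtype.ext ?_
  ext i j
  fin_cases i <;> fin_cases j <;>
    simp [rotZ] <;> ring

theorem rotZ_one : rotZ 1 = 1 := by
  refine Subtype.ext ?_
  ext i j
  fin_cases i <;> fin_cases j <;> simp [rotZ]

/-- The matrix of the rotation with Hopf coordinates `((a, b, c), u + v i)`. -/
noncomputable def hopfMatrix (a b c u v : ℝ) : Matrix (Fin 3) (Fin 3) ℝ :=
  !![(1 - a ^ 2 / (1 + c)) * u - a * b / (1 + c) * v,
      -(1 - a ^ 2 / (1 + c)) * v - a * b / (1 + c) * u, a;
    (1 - b ^ 2 / (1 + c)) * v - a * b / (1 + c) * u,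
      (1 - b ^ 2 / (1 + c)) * u + a * b / (1 + c) * v, b;
    -a * u - b * v, a * v - b * u, c]

theorem hopfQuat_coe {η : S2} (h : η ≠ south) : (hopfQuat η).1 =
    quat ((1 + η.1 2) / √(2 * (1 + η.1 2))) (-η.1 1 / √(2 * (1 + η.1 2)))
      (η.1 0 / √(2 * (1 + η.1 2))) 0 := by
  have h' : ¬ η.1 2 = -1 := fun h1 => h ((eq_south_iff η).2 h1)
  rw [hopfQuat, dif_neg h']

/-- The entries of `spin` are quadratic in the quaternion, so the square root in the normalization
occurs only squared and disappears. -/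
theorem spin_hopfQuat {η : S2} (h : η ≠ south) :
    (spin (hopfQuat η)).1 = hopfMatrix (η.1 0) (η.1 1) (η.1 2) 1 0 := by
  have hc := one_add_height_pos h
  have hs : √(2 * (1 + η.1 2)) ^ 2 = 2 * (1 + η.1 2) := Real.sq_sqrt (by linarith)
  have h1 := S2_sq η
  rw [spin_coe, hopfQuat_coe h, spinMatrix_eq, hopfMatrix]
  have hs' : √(2 * (1 + η.1 2)) ≠ 0 := by positivity
  generalize √(2 * (1 + η.1 2)) = s at hs hs'
  generalize η.1 0 = a at h1 ⊢
  generalize η.1 1 = b at h1 ⊢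
  generalize η.1 2 = c at h1 hs hc ⊢
  -- Expressing the height through the root `s` turns every entry into a rational identity in `a`,
  -- `b`, `s`.
  obtain rfl : c = s ^ 2 / 2 - 1 := by linarith
  ext i j
  fin_cases i <;> fin_cases j <;> simp [quat] <;> field_simp <;> nlinarith [h1]

theorem hopfRot_coe {η : S2} (h : η ≠ south) (φ : S1) :
    (hopfRot (η, φ)).1 = hopfMatrix (η.1 0) (η.1 1) (η.1 2) φ.1.re φ.1.im := by
  have : (hopfRot (η, φ)).1 = (spin (hopfQuat η)).1 * (rotZ φ).1 := rfl
  rw [this, spin_hopfQuat h]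
  ext i j
  fin_cases i <;> fin_cases j <;>
    simp [rotZ, hopfMatrix, Matrix.mul_apply, Fin.sum_univ_three] <;> ring

theorem poleImage_hopfRot {η : S2} (h : η ≠ south) (φ : S1) : poleImage (hopfRot (η, φ)) = η := by
  refine S2_ext fun i => ?_
  rw [poleImage_apply, hopfRot_coe h]
  fin_cases i <;> simp [hopfMatrix]

theorem hopfRot_one (η : S2) : hopfRot (η, 1) = spin (hopfQuat η) := by
  simp [hopfRot, rotZ_one]

theorem hopfRot_mul_rotZ (η : S2) (φ ψ : S1) : hopfRot (η, φ) * rotZ ψ = hopfRot (η, φ * ψ) := by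
  simp only [hopfRot, rotZ_mul, mul_assoc]

/-- The angular Hopf coordinate as a function of the matrix entries. -/
noncomputable def hopfAngle (M : Fin 3 → Fin 3 → ℝ) : ℂ :=
  ((M 0 0 + M 1 1) / (1 + M 2 2) : ℝ) + ((M 1 0 - M 0 1) / (1 + M 2 2) : ℝ) * Complex.I

theorem hopfAngle_re (M : Fin 3 → Fin 3 → ℝ) :
    (hopfAngle M).re = (M 0 0 + M 1 1) / (1 + M 2 2) := by
  simp only [hopfAngle, Complex.add_re, Complex.re_ofReal_mul, Complex.ofReal_re, Complex.I_re,
    mul_zero, add_zero]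

theorem hopfAngle_im (M : Fin 3 → Fin 3 → ℝ) :
    (hopfAngle M).im = (M 1 0 - M 0 1) / (1 + M 2 2) := by
  simp only [hopfAngle, Complex.add_im, Complex.im_ofReal_mul, Complex.ofReal_im, Complex.I_im,
    mul_one, zero_add]

/-- In the sum of the first two diagonal entries the mixed terms `a * b * v` cancel, and `a ^ 2 + b
^ 2 = 1 - c ^ 2` leaves `(1 + c) * u`; the difference of the two off-diagonal entries is `(1 + c) *
v` in the same way. -/
theorem hopfAngle_hopfRot {η : S2} (h : η ≠ south) (φ : S1) :
    hopfAngle (embRot (hopfRot (η, φ))) = φ := by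
  have hc := one_add_height_pos h
  have h1 := S2_sq η
  have e : embRot (hopfRot (η, φ)) =
      fun i j => hopfMatrix (η.1 0) (η.1 1) (η.1 2) φ.1.re φ.1.im i j := by
    rw [← hopfRot_coe h]; rfl
  rw [e]
  generalize η.1 0 = a at *
  generalize η.1 1 = b at *
  generalize η.1 2 = c at *
  apply Complex.ext
  · rw [hopfAngle_re]
    simp [hopfMatrix]
    field_simp
    linear_combination (-φ.1.re) * h1
  · rw [hopfAngle_im]
    simp [hopfMatrix]
    field_simp
    linear_combination (-φ.1.im) * h1

/-! ### The action on vectors and the rotations over a given point of the sphere. -/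

theorem act_mul (R S : SO3) (t : E3) : act (R * S) t = act R (act S t) := by
  simp [act, Matrix.mulVec_mulVec]

theorem act_one (t : E3) : act 1 t = t := by
  simp [act]

theorem act_add (R : SO3) (s t : E3) : act R (s + t) = act R s + act R t := by
  simp [act, Matrix.mulVec_add]

theorem transpose_mul_self_SO3 (R : SO3) : R.1.transpose * R.1 = 1 :=
  mul_eq_one_comm.1 (mem_SO3_iff.1 R.2).1

/-- The third column is `e₃`, so the third row, being a unit vector, is `e₃` as well. What remains
is a two by two block with unit columns and determinant one. -/
theorem exists_eq_rotZ {Q : SO3} (h : poleImage Q = north) : ∃ φ, Q = rotZ φ := by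
  have e : ∀ i, Q.1 i 2 = north.1 i := fun i => by rw [← h, poleImage_apply]
  have e0 : Q.1 0 2 = 0 := by rw [e]; simp [north]
  have e1 : Q.1 1 2 = 0 := by rw [e]; simp [north]
  have e2 : Q.1 2 2 = 1 := by rw [e]; simp [north]
  have hQ := (mem_SO3_iff.1 Q.2).1
  have hQ' := transpose_mul_self_SO3 Q
  have hd := (mem_SO3_iff.1 Q.2).2
  have r := congrFun (congrFun hQ 2) 2
  have c0 := congrFun (congrFun hQ' 0) 0
  have c1 := congrFun (congrFun hQ' 1) 1
  rw [Matrix.det_fin_three] at hd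
  simp [Matrix.mul_apply, Fin.sum_univ_three, e0, e1, e2] at r c0 c1 hd
  have r0 : Q.1 2 0 = 0 := by nlinarith [sq_nonneg (Q.1 2 0), sq_nonneg (Q.1 2 1)]
  have r1 : Q.1 2 1 = 0 := by nlinarith [sq_nonneg (Q.1 2 0), sq_nonneg (Q.1 2 1)]
  rw [r0] at c0
  rw [r1] at c1
  -- The sum of the squared lengths of the two columns minus twice the determinant is a sum of two
  -- squares, and here it equals `1 + 1 - 2`.
  have k : (Q.1 0 0 - Q.1 1 1) ^ 2 + (Q.1 0 1 + Q.1 1 0) ^ 2 = 0 := by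
    linear_combination c0 + c1 - 2 * hd
  have k0 : Q.1 1 1 = Q.1 0 0 := by
    nlinarith [sq_nonneg (Q.1 0 0 - Q.1 1 1), sq_nonneg (Q.1 0 1 + Q.1 1 0)]
  have k1 : Q.1 0 1 = -Q.1 1 0 := by
    nlinarith [sq_nonneg (Q.1 0 0 - Q.1 1 1), sq_nonneg (Q.1 0 1 + Q.1 1 0)]
  refine ⟨⟨⟨Q.1 0 0, Q.1 1 0⟩, ?_⟩, SO3_ext fun i j => ?_⟩
  · rw [mem_sphere_zero_iff_norm, ← sq_eq_sq₀ (norm_nonneg _) zero_le_one, Complex.sq_norm,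
      Complex.normSq_mk]
    linarith
  · fin_cases i <;> fin_cases j <;> simp [rotZ, e0, e1, e2, r0, r1, k0, k1]

theorem coe_poleImage (R : SO3) : (poleImage R : E3) = act R north := rfl

/-- `R` and `S = spin (hopfQuat (poleImage R))` send `e₃` to the same point, so `S⁻¹ * R` fixes
`e₃`. -/
theorem exists_eq_hopfRot {R : SO3} (h : R ∈ rotDomain) : ∃ φ, R = hopfRot (poleImage R, φ) := by
  set S := spin (hopfQuat (poleImage R)) with hS
  have hSp : poleImage S = poleImage R := by rw [hS, ← hopfRot_one]; exact poleImage_hopfRot h 1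
  obtain ⟨φ, hφ⟩ := exists_eq_rotZ (Q := S⁻¹ * R) (by
    refine Subtype.ext ?_
    rw [coe_poleImage, act_mul, ← coe_poleImage R, ← hSp, coe_poleImage, ← act_mul,
      inv_mul_cancel, act_one])
  exact ⟨φ, by rw [hopfRot, ← hφ]; simp [hS]⟩

theorem hopfCoord_fst (R : SO3) : (hopfCoord R).1 = poleImage R := rfl

theorem hopfRot_hopfCoord {R : SO3} (h : R ∈ rotDomain) : hopfRot (hopfCoord R) = R := by
  have h1 := exists_eq_hopfRot h
  rw [hopfCoord, dif_pos h1]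
  exact h1.choose_spec.symm

theorem hopfCoord_snd {R : SO3} (h : R ∈ rotDomain) :
    ((hopfCoord R).2 : ℂ) = hopfAngle (embRot R) := by
  have h1 := hopfRot_hopfCoord h
  have h2 := hopfAngle_hopfRot (η := (hopfCoord R).1) h (hopfCoord R).2
  rw [← h2, Prod.mk.eta, h1]

theorem hopfRot_mem {p : S2 × S1} (h : p ∈ hopfDomain) : hopfRot p ∈ rotDomain := by
  change poleImage (hopfRot (p.1, p.2)) ≠ south
  rw [poleImage_hopfRot h]
  exact h

theorem hopfCoord_hopfRot {p : S2 × S1} (h : p ∈ hopfDomain) : hopfCoord (hopfRot p) = p := by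
  refine Prod.ext (poleImage_hopfRot h p.2) (Subtype.ext ?_)
  rw [hopfCoord_snd (hopfRot_mem h)]
  exact hopfAngle_hopfRot h p.2

/-- At the south pole `hopfQuat` has the value `1`, so `hopfRot (south, φ)` is `rotZ φ`, which fixes
`e₃` and cannot equal `R`. Knowing that the placeholder is taken there makes `hopfCoord` measurable
everywhere. -/
theorem hopfCoord_snd_of_south {R : SO3} (h : R ∉ rotDomain) : (hopfCoord R).2 = 1 := by
  rw [hopfCoord]
  refine dif_neg ?_
  rintro ⟨φ, hφ⟩
  have h' : poleImage R = south := not_not.1 h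
  have h1 := congrArg (fun S : SO3 => S.1 2 2) hφ
  have h2 : R.1 2 2 = -1 := by rw [← poleImage_apply, h']; simp [south]
  rw [h'] at h1
  simp [h2, hopfRot, hopfQuat, south, spin, spinMatrix_eq, rotZ] at h1
  norm_num at h1

/-! ### Closest quaternions and explicit formulas -/

theorem quat_re (w x y z : ℝ) : (quat w x y z).re = w := rfl

theorem quat_imI (w x y z : ℝ) : (quat w x y z).imI = x := rfl

theorem quat_imJ (w x y z : ℝ) : (quat w x y z).imJ = y := rfl

theorem quat_imK (w x y z : ℝ) : (quat w x y z).imK = z := rfl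

theorem angle_one_S3 (q : S3) : InnerProductGeometry.angle (1 : ℍ[ℝ]) q = Real.arccos q.1.re := by
  have h : ‖q.1‖ = 1 := by simp
  rw [InnerProductGeometry.angle, h, norm_one, mul_one, div_one, Quaternion.inner_def]
  simp

/-- This quantity is constant along each Hopf fibre. It drives the minimality of `hopfQuat` and
shows that `w` and `z` vanish together exactly over the south pole. -/
theorem poleImage_spin_sq (q : S3) :
    q.1.re ^ 2 + q.1.imK ^ 2 = (1 + (poleImage (spin q)).1 2) / 2 := by
  have h := S3_sq q
  rw [poleImage_apply, spin_coe, spinMatrix_eq]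
  simp
  linarith

/-- The angle to `1` is the arccosine of the real part, which is strictly decreasing. On the fibre
the square of the real part is at most `(1 + c) / 2`, with equality only for `z = 0`. -/
theorem angle_hopfQuat_lt {η : S2} (hη : η ≠ south) {q : S3} (hq : poleImage (spin q) = η)
    (hne : q ≠ hopfQuat η) :
    InnerProductGeometry.angle (1 : ℍ[ℝ]) (hopfQuat η) <
      InnerProductGeometry.angle (1 : ℍ[ℝ]) q := by
  have hc := one_add_height_pos hη
  have hS := S3_sq q
  have h1 := poleImage_spin_sq q
  rw [hq] at h1
  have hs0 : 0 < √(2 * (1 + η.1 2)) := by positivity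
  have hs : √(2 * (1 + η.1 2)) ^ 2 = 2 * (1 + η.1 2) := Real.sq_sqrt (by linarith)
  have hre : (hopfQuat η).1.re = √(2 * (1 + η.1 2)) / 2 := by
    rw [hopfQuat_coe hη]
    change (1 + η.1 2) / √(2 * (1 + η.1 2)) = _
    rw [div_eq_div_iff hs0.ne' two_ne_zero, ← pow_two, hs]
    ring
  have hle : q.1.re ≤ (hopfQuat η).1.re := by
    rw [hre]
    refine le_of_sq_le_sq ?_ (by positivity)
    rw [div_pow, hs]
    nlinarith [sq_nonneg q.1.imK]
  rw [angle_one_S3, angle_one_S3]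
  refine Real.strictAntiOn_arccos ⟨?_, ?_⟩ ⟨?_, ?_⟩ (lt_of_le_of_ne hle fun h => hne ?_)
  · nlinarith [sq_nonneg q.1.imI, sq_nonneg q.1.imJ, sq_nonneg q.1.imK]
  · nlinarith [sq_nonneg q.1.imI, sq_nonneg q.1.imJ, sq_nonneg q.1.imK]
  · have := S3_sq (hopfQuat η)
    rw [hre] at *
    linarith
  · have := S3_sq (hopfQuat η)
    nlinarith [sq_nonneg (hopfQuat η).1.imI, sq_nonneg (hopfQuat η).1.imJ,
      sq_nonneg (hopfQuat η).1.imK]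
  -- If the real parts agree, then `z = 0`, and `a = 2 w y`, `b = -2 w x` with `w > 0` determine `x`
  -- and `y`.
  · rw [hre] at h
    have hz : q.1.imK = 0 := by
      have : q.1.imK ^ 2 = 0 := by rw [h, div_pow, hs] at h1; linarith
      simpa using this
    have ha : η.1 0 = 2 * (q.1.imI * q.1.imK + q.1.re * q.1.imJ) := by
      rw [← hq, poleImage_apply, spin_coe, spinMatrix_eq]; simp
    have hb : η.1 1 = 2 * (q.1.imJ * q.1.imK - q.1.re * q.1.imI) := by
      rw [← hq, poleImage_apply, spin_coe, spinMatrix_eq]; simp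
    rw [hz, h] at ha hb
    refine Subtype.ext ?_
    rw [hopfQuat_coe hη]
    refine QuaternionAlgebra.ext ?_ ?_ ?_ ?_
    · rw [h]
      change _ = (1 + η.1 2) / √(2 * (1 + η.1 2))
      rw [div_eq_div_iff two_ne_zero hs0.ne', ← pow_two, hs]
      ring
    · change _ = -η.1 1 / √(2 * (1 + η.1 2))
      rw [eq_div_iff hs0.ne']
      linarith
    · change _ = η.1 0 / √(2 * (1 + η.1 2))
      rw [eq_div_iff hs0.ne']
      linarith
    · exact hz

/-- Both sides are `(w + i z) ^ 2 / |w + i z| ^ 2`: doubling the angle makes the sign of `(w, z)`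
irrelevant. -/
theorem exp_two_arctanQuot {z w : ℝ} (h : w ^ 2 + z ^ 2 ≠ 0) :
    Complex.exp (((2 * arctanQuot z w : ℝ) : ℂ) * Complex.I) =
      ((w ^ 2 - z ^ 2) / (w ^ 2 + z ^ 2) : ℝ) +
        (2 * w * z / (w ^ 2 + z ^ 2) : ℝ) * Complex.I := by
  rw [Complex.exp_mul_I, ← Complex.ofReal_cos, ← Complex.ofReal_sin]
  suffices hcs : Real.cos (2 * arctanQuot z w) = (w ^ 2 - z ^ 2) / (w ^ 2 + z ^ 2) ∧
      Real.sin (2 * arctanQuot z w) = 2 * w * z / (w ^ 2 + z ^ 2) by rw [hcs.1, hcs.2]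
  unfold arctanQuot
  split_ifs with hw hq
  · subst hw
    have hz : z ≠ 0 := by rintro rfl; simp at h
    rw [mul_div_cancel₀ _ two_ne_zero]
    constructor
    · rw [Real.cos_pi]; field_simp; norm_num
    · simp
  all_goals
    have hp : 0 < 1 + (z / w) ^ 2 := by positivity
    have hc : Real.cos (2 * Real.arctan (z / w)) = (w ^ 2 - z ^ 2) / (w ^ 2 + z ^ 2) := by
      rw [Real.cos_two_mul, Real.cos_sq_arctan]
      field_simp
      ring
    have hs : Real.sin (2 * Real.arctan (z / w)) = 2 * w * z / (w ^ 2 + z ^ 2) := by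
      rw [Real.sin_two_mul, Real.sin_arctan, Real.cos_arctan]
      have h2 : √(1 + (z / w) ^ 2) ^ 2 = 1 + (z / w) ^ 2 := Real.sq_sqrt hp.le
      have h3 : 2 * (z / w / √(1 + (z / w) ^ 2)) * (1 / √(1 + (z / w) ^ 2)) =
          2 * (z / w) / √(1 + (z / w) ^ 2) ^ 2 := by ring
      rw [h3, h2]
      field_simp
  · exact ⟨hc, hs⟩
  -- The shift by `π` that brings the arctangent into `[0, π)` becomes a full turn after doubling.
  · rw [mul_add, Real.cos_add_two_pi, Real.sin_add_two_pi]
    exact ⟨hc, hs⟩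

/-- The right side is `(w + i z) ^ 2 / |w + i z| ^ 2`; the coordinates `x` and `y` do not enter the
angle. -/
theorem hopfAngle_spin (q : S3) : hopfAngle (embRot (spin q)) =
    ((q.1.re ^ 2 - q.1.imK ^ 2) / (q.1.re ^ 2 + q.1.imK ^ 2) : ℝ) +
      (2 * q.1.re * q.1.imK / (q.1.re ^ 2 + q.1.imK ^ 2) : ℝ) * Complex.I := by
  have h := S3_sq q
  have e : ∀ i j, embRot (spin q) i j = spinMatrix q i j := fun i j => rfl
  have hd : 1 + embRot (spin q) 2 2 = 2 * (q.1.re ^ 2 + q.1.imK ^ 2) := by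
    rw [e, spinMatrix_eq]; simp; linarith
  have hn : embRot (spin q) 0 0 + embRot (spin q) 1 1 = 2 * (q.1.re ^ 2 - q.1.imK ^ 2) := by
    rw [e, e, spinMatrix_eq]; simp; ring
  have hm : embRot (spin q) 1 0 - embRot (spin q) 0 1 = 2 * (2 * q.1.re * q.1.imK) := by
    rw [e, e, spinMatrix_eq]; simp; ring
  rw [hopfAngle, hd, hn, hm, mul_div_mul_left _ _ two_ne_zero, mul_div_mul_left _ _ two_ne_zero]

theorem hopfCoord_spin {q : S3} {w x y z : ℝ} (hq : (q : ℍ[ℝ]) = quat w x y z)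
    (h : spin q ∈ rotDomain) :
    ((hopfCoord (spin q)).1 : E3) =
        !₂[2 * (x * z + w * y), 2 * (y * z - w * x), 1 - 2 * (x ^ 2 + y ^ 2)] ∧
      ((hopfCoord (spin q)).2 : ℂ) =
        Complex.exp (((2 * arctanQuot z w : ℝ) : ℂ) * Complex.I) := by
  have hS := S3_sq q
  have hp := poleImage_spin_sq q
  have hpos := one_add_height_pos h
  have hw : q.1.re = w := by rw [hq]; rfl
  have hx : q.1.imI = x := by rw [hq]; rfl
  have hy : q.1.imJ = y := by rw [hq]; rfl
  have hz : q.1.imK = z := by rw [hq]; rfl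
  constructor
  · rw [hopfCoord_fst]
    refine PiLp.ext fun i => ?_
    rw [poleImage_apply, spin_coe, spinMatrix_eq]
    rw [hw, hx, hy, hz] at hS ⊢
    fin_cases i <;> simp
    linarith
  · rw [hopfCoord_snd h, hopfAngle_spin, exp_two_arctanQuot, hw, hz]
    rw [hw, hz] at hp
    rw [hp]
    positivity

theorem spin_cos_sin {φ : S1} {t : ℝ} (hφ : (φ : ℂ) = Complex.exp ((t : ℂ) * Complex.I)) {q : S3}
    (hq : q.1 = quat (Real.cos (t / 2)) 0 0 (Real.sin (t / 2))) : spin q = rotZ φ := by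
  have hre : φ.1.re = Real.cos t := by
    rw [hφ, Complex.exp_ofReal_mul_I_re]
  have him : φ.1.im = Real.sin t := by
    rw [hφ, Complex.exp_ofReal_mul_I_im]
  have hc : Real.cos t = Real.cos (t / 2) ^ 2 - Real.sin (t / 2) ^ 2 := by
    rw [← Real.cos_two_mul']; ring_nf
  have hs : Real.sin t = 2 * Real.sin (t / 2) * Real.cos (t / 2) := by
    rw [← Real.sin_two_mul]; ring_nf
  have h1 := Real.sin_sq_add_cos_sq (t / 2)
  refine Subtype.ext ?_
  rw [spin_coe, spinMatrix_eq, hq, rotZ]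
  simp only [hre, him, hc, hs]
  ext i j
  fin_cases i <;> fin_cases j <;> simp [quat] <;> linarith

theorem exists_hopfRot_eq_spin {η : S2} {φ : S1} {a b c t : ℝ} (hη : η ≠ south)
    (he : (η : E3) = !₂[a, b, c]) (hφ : (φ : ℂ) = Complex.exp ((t : ℂ) * Complex.I)) :
    ∃ q : S3, hopfRot (η, φ) = spin q ∧
      (q : ℍ[ℝ]) = (1 / √(2 * (1 + c))) •
        quat ((1 + c) * Real.cos (t / 2))
          (a * Real.sin (t / 2) - b * Real.cos (t / 2))
          (a * Real.cos (t / 2) + b * Real.sin (t / 2))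
          ((1 + c) * Real.sin (t / 2)) := by
  -- The lift of `rotZ φ` to the unit quaternions, with half the angle; the required quaternion is
  -- the product `hopfQuat η * r`.
  let r : S3 := ⟨quat (Real.cos (t / 2)) 0 0 (Real.sin (t / 2)), by
    rw [mem_sphere_zero_iff_norm, ← sq_eq_sq₀ (norm_nonneg _) zero_le_one, pow_two,
      ← Quaternion.normSq_eq_norm_mul_self, Quaternion.normSq_def']
    simp [quat]⟩
  refine ⟨hopfQuat η * r, ?_, ?_⟩
  · rw [spin_mul, spin_cos_sin (q := r) hφ rfl, hopfRot]
  · have h0 : η.1 0 = a := by rw [he]; simp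
    have h1 : η.1 1 = b := by rw [he]; simp
    have h2 : η.1 2 = c := by rw [he]; simp
    have hm : ((hopfQuat η * r : S3) : ℍ[ℝ]) =
      (hopfQuat η).1 * quat (Real.cos (t / 2)) 0 0 (Real.sin (t / 2)) := rfl
    rw [hm, hopfQuat_coe hη, h0, h1, h2]
    refine Quaternion.ext _ _ ?_ ?_ ?_ ?_ <;>
      simp only [quat_re, quat_imI, quat_imJ, quat_imK, Quaternion.re_mul, Quaternion.imI_mul, Quaternion.imJ_mul,
        Quaternion.imK_mul, Quaternion.re_smul, Quaternion.imI_smul, Quaternion.imJ_smul,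
        Quaternion.imK_smul, smul_eq_mul] <;> ring

/-! ### Smoothness -/

theorem SmoothOnVia.mono {X Y E F : Type*} [NormedAddCommGroup E] [NormedSpace ℝ E]
    [NormedAddCommGroup F] [NormedSpace ℝ F] {i : X → E} {j : Y → F} {f : X → Y} {S T : Set X}
    (h : SmoothOnVia i j f T) (hST : S ⊆ T) : SmoothOnVia i j f S := by
  intro x hx
  obtain ⟨U, hU, hxU, Φ, hΦ, he⟩ := h x (hST hx)
  exact ⟨U, hU, hxU, Φ, hΦ, fun x' hx' => he x' (hST hx')⟩

theorem contDiffOn_hopfAngle :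
    ContDiffOn ℝ ((⊤ : ℕ∞) : WithTop ℕ∞) hopfAngle {M | 1 + M 2 2 ≠ 0} := by
  unfold hopfAngle
  have hd : ContDiffOn ℝ ((⊤ : ℕ∞) : WithTop ℕ∞) (fun M : Fin 3 → Fin 3 → ℝ => 1 + M 2 2)
      {M | 1 + M 2 2 ≠ 0} := by fun_prop
  refine ContDiffOn.add ?_ (ContDiffOn.mul ?_ contDiffOn_const)
  · exact Complex.ofRealCLM.contDiff.comp_contDiffOn
      (ContDiffOn.div (by fun_prop) hd fun M hM => hM)
  · exact Complex.ofRealCLM.contDiff.comp_contDiffOn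
      (ContDiffOn.div (by fun_prop) hd fun M hM => hM)

theorem isOpen_one_add_apply_ne_zero : IsOpen {M : Fin 3 → Fin 3 → ℝ | 1 + M 2 2 ≠ 0} :=
  isOpen_ne_fun (by fun_prop) continuous_const

/-- The Hopf coordinates as a function of the matrix entries. -/
noncomputable def hopfCoordExt (M : Fin 3 → Fin 3 → ℝ) : E3 × ℂ :=
  (WithLp.toLp 2 fun i => M i 2, hopfAngle M)

theorem contDiffOn_hopfCoordExt :
    ContDiffOn ℝ ((⊤ : ℕ∞) : WithTop ℕ∞) hopfCoordExt {M | 1 + M 2 2 ≠ 0} := by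
  refine ContDiffOn.prodMk ?_ contDiffOn_hopfAngle
  refine ContDiff.contDiffOn ?_
  rw [contDiff_euclidean]
  intro i
  fun_prop

theorem hopfCoordExt_embRot {R : SO3} (h : R ∈ rotDomain) :
    hopfCoordExt (embRot R) = embHopf (hopfCoord R) := by
  refine Prod.ext (PiLp.ext fun i => ?_) (hopfCoord_snd h).symm
  exact (poleImage_apply R i).symm

theorem one_add_embRot_ne_zero {R : SO3} (h : R ∈ rotDomain) : 1 + embRot R 2 2 ≠ 0 := by
  have := one_add_height_pos h
  rw [poleImage_apply] at this
  exact this.ne'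

theorem smoothOnVia_hopfCoord : SmoothOnVia embRot embHopf hopfCoord rotDomain := fun _ hR =>
  ⟨_, isOpen_one_add_apply_ne_zero, one_add_embRot_ne_zero hR, hopfCoordExt,
    contDiffOn_hopfCoordExt, fun _ hR' _ => hopfCoordExt_embRot hR'⟩

/-- The matrix with given Hopf coordinates, as a function on the ambient space. -/
noncomputable def hopfRotExt (p : E3 × ℂ) : Fin 3 → Fin 3 → ℝ :=
  fun i j => hopfMatrix (p.1 0) (p.1 1) (p.1 2) p.2.re p.2.im i j

theorem contDiffOn_hopfRotExt :
    ContDiffOn ℝ ((⊤ : ℕ∞) : WithTop ℕ∞) hopfRotExt {p | 1 + p.1 2 ≠ 0} := by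
  have hc : ∀ i, ContDiffOn ℝ ((⊤ : ℕ∞) : WithTop ℕ∞) (fun p : E3 × ℂ => p.1 i)
      {p | 1 + p.1 2 ≠ 0} := fun i =>
    ((contDiff_euclidean.1 contDiff_id i).comp contDiff_fst).contDiffOn
  have hre : ContDiffOn ℝ ((⊤ : ℕ∞) : WithTop ℕ∞) (fun p : E3 × ℂ => p.2.re)
      {p | 1 + p.1 2 ≠ 0} := (Complex.reCLM.contDiff.comp contDiff_snd).contDiffOn
  have him : ContDiffOn ℝ ((⊤ : ℕ∞) : WithTop ℕ∞) (fun p : E3 × ℂ => p.2.im)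
      {p | 1 + p.1 2 ≠ 0} := (Complex.imCLM.contDiff.comp contDiff_snd).contDiffOn
  have h0 := hc 0
  have h1 := hc 1
  have h2 := hc 2
  have hd : ContDiffOn ℝ ((⊤ : ℕ∞) : WithTop ℕ∞) (fun p : E3 × ℂ => (1 + p.1 2)⁻¹)
      {p | 1 + p.1 2 ≠ 0} := (contDiffOn_const.add h2).inv fun p hp => hp
  refine contDiffOn_pi.2 fun i => contDiffOn_pi.2 fun j => ?_
  fin_cases i <;> fin_cases j <;> simp [hopfRotExt, hopfMatrix, div_eq_mul_inv] <;> fun_prop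

theorem hopfRotExt_embHopf {p : S2 × S1} (h : p ∈ hopfDomain) :
    hopfRotExt (embHopf p) = embRot (hopfRot p) := by
  funext i j
  exact (congrFun (congrFun (hopfRot_coe h p.2) i) j).symm

theorem isOpen_one_add_height_ne_zero : IsOpen {p : E3 × ℂ | 1 + p.1 2 ≠ 0} :=
  isOpen_ne_fun (by fun_prop) continuous_const

theorem smoothOnVia_hopfRot : SmoothOnVia embHopf embRot hopfRot hopfDomain := fun _ hp =>
  ⟨_, isOpen_one_add_height_ne_zero, (one_add_height_pos hp).ne', hopfRotExt,
    contDiffOn_hopfRotExt, fun _ hp' _ => hopfRotExt_embHopf hp'⟩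

theorem isDiffeoOnVia_hopfCoord :
    IsDiffeoOnVia embRot embHopf hopfCoord hopfRot rotDomain hopfDomain :=
  ⟨fun _ h => h, fun _ h => hopfRot_mem h,
    ⟨fun _ h => hopfRot_hopfCoord h, fun _ h => hopfCoord_hopfRot h⟩,
    smoothOnVia_hopfCoord, smoothOnVia_hopfRot⟩

/-! ### Removal of the branch cut `φ = 0`. -/

theorem hopfStar_subset : hopfStar ⊆ hopfDomain := fun _ h => h.1

/-- Over the south pole `w ^ 2 + z ^ 2 = 0`, which excludes `z ≠ 0`. -/
theorem rotStar_subset : rotStar ⊆ rotDomain := by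
  rintro _ ⟨q, hq, rfl⟩ h
  have h1 := poleImage_spin_sq q
  rw [(eq_south_iff _).1 h] at h1
  have h2 : 0 < q.1.imK ^ 2 := by
    have : q.1.imK ≠ 0 := hq
    positivity
  nlinarith [sq_nonneg q.1.re]

/-- The unit number `(w + i z) ^ 2 / |w + i z| ^ 2` is `1` exactly when `w + i z` is real. This
matches the branch cut with the rotations left out of `rotStar`. -/
theorem hopfCoord_spin_snd_eq_one_iff {q : S3} (h : spin q ∈ rotDomain) :
    (hopfCoord (spin q)).2 = 1 ↔ q.1.imK = 0 := by
  have hp := one_add_height_pos h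
  have h1 := poleImage_spin_sq q
  have hpos : 0 < q.1.re ^ 2 + q.1.imK ^ 2 := by rw [h1]; positivity
  rw [Subtype.ext_iff, hopfCoord_snd h, hopfAngle_spin]
  constructor
  · intro h2
    have h3 := congrArg Complex.re h2
    simp only [Complex.add_re, Complex.re_ofReal_mul, Complex.ofReal_re, Complex.I_re,
      mul_zero, add_zero] at h3
    have h4 : (q.1.re ^ 2 - q.1.imK ^ 2) / (q.1.re ^ 2 + q.1.imK ^ 2) = 1 := h3
    rw [div_eq_one_iff_eq hpos.ne'] at h4
    have : q.1.imK ^ 2 = 0 := by linarith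
    simpa using this
  · intro h2
    have h3 : q.1.re ≠ 0 := by
      intro h4
      rw [h2, h4] at hpos
      simp at hpos
    simp [h2, h3]

theorem exists_S1_eq_exp (φ : S1) : ∃ t : ℝ, (φ : ℂ) = Complex.exp ((t : ℂ) * Complex.I) := by
  refine ⟨Complex.arg φ, ?_⟩
  have h := Complex.norm_mul_exp_arg_mul_I (φ : ℂ)
  rw [norm_eq_of_mem_sphere φ] at h
  simpa using h.symm

theorem exists_hopfRot_eq_spin' {p : S2 × S1} (h : p ∈ hopfDomain) :
    ∃ q : S3, hopfRot p = spin q := by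
  obtain ⟨t, ht⟩ := exists_S1_eq_exp p.2
  obtain ⟨q, hq, -⟩ := exists_hopfRot_eq_spin (η := p.1) (a := p.1.1 0) (b := p.1.1 1)
    (c := p.1.1 2) h (PiLp.ext fun i => by fin_cases i <;> simp) ht
  exact ⟨q, hq⟩

theorem mapsTo_hopfCoord_rotStar : MapsTo hopfCoord rotStar hopfStar := by
  intro R hR
  have hd := rotStar_subset hR
  obtain ⟨q, hq, rfl⟩ := hR
  exact ⟨hd, fun h => hq ((hopfCoord_spin_snd_eq_one_iff hd).1 h)⟩

theorem mapsTo_hopfRot_hopfStar : MapsTo hopfRot hopfStar rotStar := by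
  intro p hp
  obtain ⟨q, hq⟩ := exists_hopfRot_eq_spin' hp.1
  refine ⟨q, fun h => hp.2 ?_, hq.symm⟩
  have hd : spin q ∈ rotDomain := hq ▸ hopfRot_mem hp.1
  have := (hopfCoord_spin_snd_eq_one_iff hd).2 h
  rwa [← hq, hopfCoord_hopfRot hp.1] at this

theorem isDiffeoOnVia_hopfCoord_star :
    IsDiffeoOnVia embRot embHopf hopfCoord hopfRot rotStar hopfStar :=
  ⟨mapsTo_hopfCoord_rotStar, mapsTo_hopfRot_hopfStar,
    ⟨fun _ h => hopfRot_hopfCoord (rotStar_subset h), fun _ h => hopfCoord_hopfRot h.1⟩,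
    smoothOnVia_hopfCoord.mono rotStar_subset, smoothOnVia_hopfRot.mono hopfStar_subset⟩

/-! ### Poses and contact parameters: the translation as an extra factor. -/

theorem xiInv_xi {x : SE3} (h : x ∈ poseDomain) : xiInv (xi x) = x := by
  refine Prod.ext (PiLp.ext fun i => ?_) (hopfRot_hopfCoord h)
  fin_cases i <;> simp [xi, xiInv]

theorem xi_xiInv {y : Contact} (h : y ∈ contactDomain) : xi (xiInv y) = y := by
  refine Prod.ext ?_ (hopfCoord_hopfRot h)
  simp [xi, xiInv]

theorem smoothOnVia_xi : SmoothOnVia embPose embContact xi poseDomain := fun _ hx => by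
  refine ⟨Prod.snd ⁻¹' {M | 1 + M 2 2 ≠ 0}, isOpen_one_add_apply_ne_zero.preimage continuous_snd,
    one_add_embRot_ne_zero hx,
    fun p => ((p.1 0, p.1 1, p.1 2), hopfCoordExt p.2), ?_, fun x' hx' _ => ?_⟩
  · have hc : ∀ i, ContDiff ℝ ((⊤ : ℕ∞) : WithTop ℕ∞)
        (fun p : E3 × (Fin 3 → Fin 3 → ℝ) => p.1 i) := fun i =>
      (contDiff_euclidean.1 contDiff_id i).comp contDiff_fst
    refine ContDiffOn.prodMk ((hc 0).prodMk ((hc 1).prodMk (hc 2))).contDiffOn ?_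
    exact contDiffOn_hopfCoordExt.comp contDiff_snd.contDiffOn fun p hp => hp
  · exact Prod.ext rfl (hopfCoordExt_embRot hx')

theorem smoothOnVia_xiInv : SmoothOnVia embContact embPose xiInv contactDomain := fun _ hy => by
  refine ⟨Prod.snd ⁻¹' {p | 1 + p.1 2 ≠ 0},
    isOpen_one_add_height_ne_zero.preimage continuous_snd, (one_add_height_pos hy).ne',
    fun p => (!₂[p.1.1, p.1.2.1, p.1.2.2], hopfRotExt p.2), ?_, fun y' hy' _ => ?_⟩
  · refine ContDiffOn.prodMk (ContDiff.contDiffOn ?_) ?_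
    · rw [contDiff_euclidean]
      intro i
      fin_cases i <;> simp <;> fun_prop
    · exact contDiffOn_hopfRotExt.comp contDiff_snd.contDiffOn fun p hp => hp
  · exact Prod.ext rfl (hopfRotExt_embHopf hy')

theorem isDiffeoOnVia_xi :
    IsDiffeoOnVia embPose embContact xi xiInv poseDomain contactDomain :=
  ⟨fun _ h => h, fun _ h => hopfRot_mem h,
    ⟨fun _ h => xiInv_xi h, fun _ h => xi_xiInv h⟩, smoothOnVia_xi, smoothOnVia_xiInv⟩

/-! ### Invariance of the uniform measures on spheres -/

-- The measure of a subset of the sphere is, up to a constant, the volume of the cone over it. A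
-- linear isometry maps cones to cones and preserves volume.
open scoped Pointwise in
theorem measurePreserving_toSphere {E : Type*} [NormedAddCommGroup E] [InnerProductSpace ℝ E]
    [FiniteDimensional ℝ E] [MeasurableSpace E] [BorelSpace E] (e : E ≃ₗᵢ[ℝ] E)
    {f : Metric.sphere (0 : E) 1 → Metric.sphere (0 : E) 1} (hf : ∀ x, (f x : E) = e x) :
    MeasurePreserving f (volume : Measure E).toSphere (volume : Measure E).toSphere := by
  have hc : Continuous f := by
    refine continuous_induced_rng.2 ?_
    have : Subtype.val ∘ f = fun x : Metric.sphere (0 : E) 1 => e x := funext hf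
    rw [this]
    exact e.continuous.comp continuous_subtype_val
  refine ⟨hc.measurable, Measure.ext fun s hs => ?_⟩
  rw [Measure.map_apply hc.measurable hs, Measure.toSphere_apply' _ hs,
    Measure.toSphere_apply' _ (hc.measurable hs)]
  congr 1
  rw [← e.measurePreserving.measure_preimage_equiv (f := e.toHomeomorph.toMeasurableEquiv)
    (Ioo (0 : ℝ) 1 • (Subtype.val '' s))]
  congr 1
  ext x
  simp only [Set.mem_smul, mem_image, mem_preimage]
  constructor
  · rintro ⟨r, hr, _, ⟨y, hy, rfl⟩, rfl⟩
    exact ⟨r, hr, _, ⟨f y, hy, rfl⟩, by rw [hf]; exact (e.map_smul r _).symm⟩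
  · rintro ⟨r, hr, _, ⟨y, hy, rfl⟩, h⟩
    have h2 : f ⟨e.symm y, by simp⟩ = y := Subtype.ext (by rw [hf]; simp)
    refine ⟨r, hr, _, ⟨⟨e.symm y, by simp⟩, by rwa [h2], rfl⟩, ?_⟩
    apply e.injective
    rw [map_smul, LinearIsometryEquiv.apply_symm_apply]
    exact h

/-- The action of a rotation on vectors as a linear isometry. -/
noncomputable def actIsometry (R : SO3) : E3 ≃ₗᵢ[ℝ] E3 where
  toFun := act R
  invFun := act R⁻¹
  map_add' := act_add R
  map_smul' c t := by simp [act, Matrix.mulVec_smul]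
  left_inv t := by rw [← act_mul, inv_mul_cancel, act_one]
  right_inv t := by rw [← act_mul, mul_inv_cancel, act_one]
  norm_map' := norm_act R

/-- The action of a rotation on the unit sphere. -/
def sphereAct (R : SO3) (η : S2) : S2 :=
  ⟨act R η, by simpa using (norm_act R η).trans (by simp)⟩

theorem poleImage_mul (R S : SO3) : poleImage (R * S) = sphereAct R (poleImage S) :=
  Subtype.ext (act_mul R S north)

theorem measurePreserving_sphereAct (R : SO3) (m : ℝ) :
    MeasurePreserving (sphereAct R) (uniformS2 m) (uniformS2 m) :=
  (measurePreserving_toSphere (actIsometry R) fun _ => rfl).smul_measure _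

theorem measurePreserving_mul_left_S1 (α : S1) (m : ℝ) :
    MeasurePreserving (fun φ : S1 => α * φ) (uniformS1 m) (uniformS1 m) :=
  (measurePreserving_toSphere (rotation ⟨α.1, α.2⟩) fun _ => rfl).smul_measure _

-- The cone over a point lies in a line, which is a null set in dimension at least two.
open scoped Pointwise in
theorem toSphere_singleton {E : Type*} [NormedAddCommGroup E] [InnerProductSpace ℝ E]
    [FiniteDimensional ℝ E] [MeasurableSpace E] [BorelSpace E] (h : 1 < Module.finrank ℝ E)
    (x : Metric.sphere (0 : E) 1) : (volume : Measure E).toSphere {x} = 0 := by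
  rw [Measure.toSphere_apply' _ (measurableSet_singleton x), image_singleton]
  have h0 : volume (Submodule.span ℝ {x.1} : Set E) = 0 := by
    refine Measure.addHaar_submodule _ _ fun ht => ?_
    have h1 := finrank_span_singleton (K := ℝ) (v := x.1) (ne_zero_of_mem_unit_sphere x)
    rw [ht, finrank_top] at h1
    omega
  have h1 : Ioo (0 : ℝ) 1 • ({x.1} : Set E) ⊆ Submodule.span ℝ {x.1} := by
    rintro _ ⟨r, -, _, rfl, rfl⟩
    exact Submodule.smul_mem _ _ (Submodule.mem_span_singleton_self _)
  rw [measure_mono_null h1 h0, mul_zero]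

/-! ### Null sets and total masses. -/

theorem uniformS2_singleton (m : ℝ) (η : S2) : uniformS2 m {η} = 0 := by
  rw [uniformS2, Measure.smul_apply, toSphere_singleton (by simp), smul_zero]

theorem uniformS1_singleton (m : ℝ) (φ : S1) : uniformS1 m {φ} = 0 := by
  rw [uniformS1, Measure.smul_apply, toSphere_singleton (by simp), smul_zero]

theorem normalized_univ {X : Type*} [MeasurableSpace X] (μ : Measure X) [IsFiniteMeasure μ]
    (h : μ ≠ 0) (m : ℝ) : ((ENNReal.ofReal m / μ univ) • μ) univ = ENNReal.ofReal m := by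
  rw [Measure.smul_apply, smul_eq_mul]
  exact ENNReal.div_mul_cancel (by simpa using h) (measure_ne_top _ _)

theorem uniformS2_univ (m : ℝ) : uniformS2 m univ = ENNReal.ofReal m :=
  normalized_univ _ (Measure.toSphere_ne_zero _) m

theorem uniformS1_univ (m : ℝ) : uniformS1 m univ = ENNReal.ofReal m :=
  normalized_univ _ (Measure.toSphere_ne_zero _) m

theorem haarSO3_univ (m : ℝ) : haarSO3 m univ = ENNReal.ofReal m :=
  normalized_univ _ (NeZero.ne _) m

instance (m : ℝ) : IsFiniteMeasure (uniformS2 m) := ⟨by rw [uniformS2_univ]; simp⟩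

instance (m : ℝ) : IsFiniteMeasure (uniformS1 m) := ⟨by rw [uniformS1_univ]; simp⟩

instance (m : ℝ) : IsFiniteMeasure (haarSO3 m) := ⟨by rw [haarSO3_univ]; simp⟩

instance (m₂ m₁ : ℝ) : IsFiniteMeasure (hopfMeasure m₂ m₁) := by
  unfold hopfMeasure; infer_instance

theorem hopfMeasure_univ (m₂ m₁ : ℝ) :
    hopfMeasure m₂ m₁ univ = ENNReal.ofReal m₂ * ENNReal.ofReal m₁ := by
  rw [hopfMeasure, ← univ_prod_univ, Measure.prod_prod, uniformS2_univ, uniformS1_univ]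

theorem ae_fst_ne (m₂ m₁ : ℝ) (η : S2) : ∀ᵐ p ∂(hopfMeasure m₂ m₁), p.1 ≠ η := by
  rw [ae_iff]
  have : {p : S2 × S1 | ¬ p.1 ≠ η} = {η} ×ˢ univ := by ext p; simp
  rw [this, hopfMeasure, Measure.prod_prod, uniformS2_singleton, zero_mul]

theorem ae_snd_ne (m₂ m₁ : ℝ) (φ : S1) : ∀ᵐ p ∂(hopfMeasure m₂ m₁), p.2 ≠ φ := by
  rw [ae_iff]
  have : {p : S2 × S1 | ¬ p.2 ≠ φ} = univ ×ˢ {φ} := by ext p; simp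
  rw [this, hopfMeasure, Measure.prod_prod, uniformS1_singleton, mul_zero]

theorem ae_mem_hopfDomain (m₂ m₁ : ℝ) : ∀ᵐ p ∂(hopfMeasure m₂ m₁), p ∈ hopfDomain :=
  ae_fst_ne m₂ m₁ south

theorem ae_mem_hopfStar (m₂ m₁ : ℝ) : ∀ᵐ p ∂(hopfMeasure m₂ m₁), p ∈ hopfStar :=
  (ae_fst_ne m₂ m₁ south).and (ae_snd_ne m₂ m₁ 1)

/-! ### Measurability of the Hopf coordinates -/

instance : SecondCountableTopology SO3 :=
  inferInstanceAs (SecondCountableTopology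
    {M : Fin 3 → Fin 3 → ℝ // M ∈ Matrix.specialOrthogonalGroup (Fin 3) ℝ})

theorem continuous_embRot : Continuous embRot := continuous_subtype_val

theorem isInducing_embRot : Topology.IsInducing embRot := ⟨rfl⟩

theorem isInducing_embHopf : Topology.IsInducing embHopf :=
  Topology.IsInducing.subtypeVal.prodMap Topology.IsInducing.subtypeVal

theorem continuous_poleImage : Continuous poleImage := by
  refine continuous_induced_rng.2 ((PiLp.continuous_toLp 2 _).comp (continuous_pi fun i => ?_))
  have h : (fun R : SO3 => R.1.mulVec north.1.ofLp i) = fun R : SO3 => R.1 i 2 :=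
    funext fun R => poleImage_apply R i
  change Continuous fun R : SO3 => R.1.mulVec north.1.ofLp i
  rw [h]
  exact (continuous_apply_apply i 2).comp continuous_embRot

/-- `hopfCoord` and `hopfRot` are continuous off the south pole and, separately, on the exceptional
set, where the placeholder values are used. -/
theorem measurable_of_continuousOn_of_continuousOn_compl {X Y : Type*} [TopologicalSpace X]
    [MeasurableSpace X] [BorelSpace X] [TopologicalSpace Y] [MeasurableSpace Y] [BorelSpace Y]
    {f : X → Y} {s : Set X} (hs : MeasurableSet s) (h : ContinuousOn f s)
    (h' : ContinuousOn f sᶜ) : Measurable f :=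
  measurable_of_restrict_of_restrict_compl hs h.domRestrict.measurable h'.domRestrict.measurable

theorem isOpen_rotDomain : IsOpen rotDomain :=
  isOpen_ne_fun continuous_poleImage continuous_const

theorem isOpen_hopfDomain : IsOpen hopfDomain :=
  isOpen_ne_fun continuous_fst continuous_const

theorem measurable_hopfCoord : Measurable hopfCoord := by
  refine measurable_of_continuousOn_of_continuousOn_compl isOpen_rotDomain.measurableSet ?_ ?_
  · rw [isInducing_embHopf.continuousOn_iff]
    refine ContinuousOn.congr (f := hopfCoordExt ∘ embRot) ?_
      fun R hR => (hopfCoordExt_embRot hR).symm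
    exact contDiffOn_hopfCoordExt.continuousOn.comp continuous_embRot.continuousOn
      fun R hR => one_add_embRot_ne_zero hR
  · refine ContinuousOn.congr (f := fun R => (poleImage R, 1))
      (continuous_poleImage.prodMk continuous_const).continuousOn
      fun R hR => Prod.ext rfl (hopfCoord_snd_of_south hR)

theorem continuous_rotZ : Continuous rotZ := by
  refine isInducing_embRot.continuous_iff.2 (continuous_pi fun i => continuous_pi fun j => ?_)
  have hre : Continuous fun φ : S1 => φ.1.re := Complex.continuous_re.comp continuous_subtype_val
  have him : Continuous fun φ : S1 => φ.1.im := Complex.continuous_im.comp continuous_subtype_val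
  fin_cases i <;> fin_cases j <;> simp [embRot, rotZ] <;> fun_prop

theorem measurable_hopfRot : Measurable hopfRot := by
  refine measurable_of_continuousOn_of_continuousOn_compl isOpen_hopfDomain.measurableSet ?_ ?_
  · rw [isInducing_embRot.continuousOn_iff]
    refine ContinuousOn.congr (f := hopfRotExt ∘ embHopf) ?_
      fun p hp => (hopfRotExt_embHopf hp).symm
    exact contDiffOn_hopfRotExt.continuousOn.comp isInducing_embHopf.continuous.continuousOn
      fun p hp => (one_add_height_pos hp).ne'
  · have hc : Continuous fun φ : S1 => spin (hopfQuat south) * rotZ φ :=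
      (continuous_const_mul (spin (hopfQuat south))).comp continuous_rotZ
    refine ContinuousOn.congr (hc.comp continuous_snd).continuousOn fun p hp => ?_
    have : p.1 = south := not_not.1 hp
    rw [hopfRot, this]; rfl

/-! ### The Hopf coordinates transform Haar measure into a product measure -/

theorem ae_sphereAct_ne (g : SO3) (m₂ m₁ : ℝ) (η : S2) :
    ∀ᵐ p ∂(hopfMeasure m₂ m₁), sphereAct g p.1 ≠ η := by
  filter_upwards [ae_fst_ne m₂ m₁ (sphereAct g⁻¹ η)] with p hp h
  refine hp (Subtype.ext ?_)
  rw [← h]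
  change p.1.1 = act g⁻¹ (act g p.1)
  rw [← act_mul, inv_mul_cancel, act_one]

/-- Left translation by `g` in Hopf coordinates. -/
noncomputable def hopfTranslate (g : SO3) (p : S2 × S1) : S2 × S1 :=
  (sphereAct g p.1, (hopfCoord (g * hopfRot (p.1, 1))).2 * p.2)

/-- Left multiplication by `g` commutes with right multiplication by `rotZ φ`, and the latter only
multiplies the angle by `φ`. So the effect of `g` on a whole circle is determined by its effect at
`φ = 1`. -/
theorem hopfRot_hopfTranslate {g : SO3} {p : S2 × S1} (h : p.1 ≠ south)
    (h' : sphereAct g p.1 ≠ south) : hopfRot (hopfTranslate g p) = g * hopfRot p := by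
  have h1 : poleImage (g * hopfRot (p.1, 1)) = sphereAct g p.1 := by
    rw [poleImage_mul, poleImage_hopfRot h]
  have h2 : g * hopfRot (p.1, 1) ∈ rotDomain := by
    change poleImage _ ≠ south
    rwa [h1]
  have h3 := hopfRot_hopfCoord h2
  rw [hopfTranslate, ← hopfRot_mul_rotZ, ← h1, ← hopfCoord_fst, Prod.mk.eta, h3, mul_assoc,
    hopfRot_mul_rotZ, one_mul]

/-- A skew product over a rotation of the sphere: above each `η` the circle is rotated by an angle
that depends measurably on `η`. -/
theorem measurePreserving_hopfTranslate (g : SO3) (m₂ m₁ : ℝ) :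
    MeasurePreserving (hopfTranslate g) (hopfMeasure m₂ m₁) (hopfMeasure m₂ m₁) := by
  refine (measurePreserving_sphereAct g m₂).skew_product
    (g := fun η φ => (hopfCoord (g * hopfRot (η, 1))).2 * φ) ?_
    (ae_of_all _ fun η => (measurePreserving_mul_left_S1 _ m₁).map_eq)
  have h : Measurable fun η : S2 => (hopfCoord (g * hopfRot (η, 1))).2 :=
    measurable_snd.comp (measurable_hopfCoord.comp ((measurable_const_mul g).comp
      (measurable_hopfRot.comp (measurable_id.prodMk measurable_const))))
  exact (h.comp measurable_fst).mul measurable_snd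

/-- `hopfRot` intertwines `hopfTranslate g` with left multiplication by `g`, except where `η` or its
image under `g` is the south pole, which is a null set. -/
instance isMulLeftInvariant_map_hopfRot (m₂ m₁ : ℝ) :
    ((hopfMeasure m₂ m₁).map hopfRot).IsMulLeftInvariant := by
  refine ⟨fun g => ?_⟩
  rw [Measure.map_map (measurable_const_mul g) measurable_hopfRot]
  have h : (g * ·) ∘ hopfRot =ᵐ[hopfMeasure m₂ m₁] hopfRot ∘ hopfTranslate g := by
    filter_upwards [ae_fst_ne m₂ m₁ south, ae_sphereAct_ne g m₂ m₁ south] with p hp hp'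
    exact (hopfRot_hopfTranslate hp hp').symm
  rw [Measure.map_congr h, ← Measure.map_map measurable_hopfRot
    (measurePreserving_hopfTranslate g m₂ m₁).measurable,
    (measurePreserving_hopfTranslate g m₂ m₁).map_eq]

/-- On a compact group a finite left invariant measure is a multiple of Haar measure, and the total
mass determines the multiple. -/
theorem eq_smul_haarSO3 (μ : Measure SO3) [IsFiniteMeasure μ] [μ.IsMulLeftInvariant] {k m : ℝ}
    (hk : 0 ≤ k) (h : μ univ = ENNReal.ofReal (k * m)) :
    μ = ENNReal.ofReal k • haarSO3 m := by
  have h1 := Measure.isMulInvariant_eq_smul_of_compactSpace μ (Measure.haar : Measure SO3)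
  have hH : (Measure.haar : Measure SO3) univ ≠ 0 :=
    Measure.measure_univ_ne_zero.2 (NeZero.ne _)
  have hH' : (Measure.haar : Measure SO3) univ ≠ ∞ := measure_ne_top _ _
  generalize Measure.haarScalarFactor μ (Measure.haar : Measure SO3) = c at h1
  have h2 : (c : ℝ≥0∞) * (Measure.haar : Measure SO3) univ =
      ENNReal.ofReal k * ENNReal.ofReal m := by
    rw [← ENNReal.ofReal_mul hk, ← h, h1]
    rfl
  rw [haarSO3, smul_smul, ← mul_div_assoc, ← h2, ENNReal.mul_div_cancel_right hH hH', h1]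
  rfl

theorem measurePreserving_hopfRot {m₀ m₂ m₁ : ℝ} (h₀ : 0 < m₀) (h₂ : 0 < m₂) (h₁ : 0 < m₁) :
    MeasurePreserving hopfRot (hopfMeasure m₂ m₁)
      (ENNReal.ofReal (m₂ * m₁ / m₀) • haarSO3 m₀) := by
  refine ⟨measurable_hopfRot, eq_smul_haarSO3 _ (by positivity) ?_⟩
  rw [Measure.map_apply measurable_hopfRot MeasurableSet.univ, preimage_univ, hopfMeasure_univ,
    div_mul_cancel₀ _ h₀.ne', ENNReal.ofReal_mul h₂.le]

/-- Since `g ∘ f` is the identity almost everywhere, `g` carries `k • ν` back to `μ`; dividing by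
`k` gives the claim. Nothing is required of `f ∘ g`. -/
theorem measurePreserving_of_leftInverse {X Y : Type*} [MeasurableSpace X] [MeasurableSpace Y]
    {μ : Measure X} {ν : Measure Y} {f : X → Y} {g : Y → X} {k l : ℝ≥0∞}
    (hf : MeasurePreserving f μ (k • ν)) (hg : Measurable g) (h : ∀ᵐ x ∂μ, g (f x) = x)
    (hk : l * k = 1) : MeasurePreserving g ν (l • μ) := by
  refine ⟨hg, ?_⟩
  have h1 : (μ.map f).map g = μ := by
    rw [Measure.map_map hg hf.measurable, Measure.map_congr (f := g ∘ f) (g := id) h,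
      Measure.map_id]
  rw [hf.map_eq, Measure.map_smul] at h1
  rw [← h1, smul_smul, hk, one_smul]

theorem ofReal_div_mul_ofReal_div {a b : ℝ} (ha : 0 < a) (hb : 0 < b) :
    ENNReal.ofReal (a / b) * ENNReal.ofReal (b / a) = 1 := by
  rw [← ENNReal.ofReal_mul (by positivity), div_mul_div_cancel₀ hb.ne', div_self ha.ne',
    ENNReal.ofReal_one]

theorem measurePreserving_hopfCoord {m₀ m₂ m₁ : ℝ} (h₀ : 0 < m₀) (h₂ : 0 < m₂) (h₁ : 0 < m₁) :
    MeasurePreserving hopfCoord (haarSO3 m₀)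
      (ENNReal.ofReal (m₀ / (m₂ * m₁)) • hopfMeasure m₂ m₁) := by
  refine measurePreserving_of_leftInverse (measurePreserving_hopfRot h₀ h₂ h₁)
    measurable_hopfCoord ?_ (ofReal_div_mul_ofReal_div h₀ (by positivity))
  filter_upwards [ae_mem_hopfDomain m₂ m₁] with p hp using hopfCoord_hopfRot hp

/-- Haar measure is a nonzero multiple of the image of `hopfMeasure`, so null sets can be tested in
Hopf coordinates. The masses `1` there are immaterial. -/
theorem ae_haarSO3_of_ae_hopf {m₀ : ℝ} (h₀ : 0 < m₀) {P : SO3 → Prop}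
    (hm : MeasurableSet {R | P R}) (h : ∀ᵐ p ∂(hopfMeasure 1 1), P (hopfRot p)) :
    ∀ᵐ R ∂(haarSO3 m₀), P R := by
  have h1 := measurePreserving_hopfRot h₀ one_pos one_pos
  have h2 : ∀ᵐ R ∂((hopfMeasure 1 1).map hopfRot), P R :=
    (ae_map_iff h1.measurable.aemeasurable hm).2 h
  rw [h1.map_eq] at h2
  refine (Measure.ae_ennreal_smul_measure_iff ?_).1 h2
  simpa using h₀

theorem ae_mem_rotDomain {m₀ : ℝ} (h₀ : 0 < m₀) : ∀ᵐ R ∂(haarSO3 m₀), R ∈ rotDomain := by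
  refine ae_haarSO3_of_ae_hopf h₀ isOpen_rotDomain.measurableSet ?_
  filter_upwards [ae_mem_hopfDomain 1 1] with p hp using hopfRot_mem hp

/-- `rotStar` is defined as an image; as a preimage it is seen to be measurable. -/
theorem rotStar_eq : rotStar = rotDomain ∩ hopfCoord ⁻¹' hopfStar := by
  ext R
  refine ⟨fun h => ⟨rotStar_subset h, mapsTo_hopfCoord_rotStar h⟩, fun h => ?_⟩
  rw [← hopfRot_hopfCoord h.1]
  exact mapsTo_hopfRot_hopfStar h.2

theorem measurableSet_rotStar : MeasurableSet rotStar := by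
  rw [rotStar_eq]
  refine isOpen_rotDomain.measurableSet.inter (measurable_hopfCoord ?_)
  exact isOpen_hopfDomain.measurableSet.inter
    (isOpen_ne_fun continuous_snd continuous_const).measurableSet

theorem ae_mem_rotStar {m₀ : ℝ} (h₀ : 0 < m₀) : ∀ᵐ R ∂(haarSO3 m₀), R ∈ rotStar := by
  refine ae_haarSO3_of_ae_hopf h₀ measurableSet_rotStar ?_
  filter_upwards [ae_mem_hopfStar 1 1] with p hp using mapsTo_hopfRot_hopfStar hp

/-! ### Invariance of the measure on poses -/

instance (m : ℝ) : (haarSO3 m).IsMulLeftInvariant := by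
  unfold haarSO3; infer_instance

/-- A right translate of Haar measure is again left invariant, with the same total mass. -/
theorem measurePreserving_mul_right_haarSO3 (m : ℝ) (g : SO3) :
    MeasurePreserving (· * g) (haarSO3 m) (haarSO3 m) := by
  refine ⟨measurable_mul_const g, ?_⟩
  have := eq_smul_haarSO3 ((haarSO3 m).map (· * g)) (k := 1) (m := m) zero_le_one (by
    rw [Measure.map_apply (measurable_mul_const g) MeasurableSet.univ, preimage_univ,
      haarSO3_univ, one_mul])
  rw [this, ENNReal.ofReal_one, one_smul]

instance (m : ℝ) : SigmaFinite (poseMeasure m) := by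
  unfold poseMeasure; infer_instance

instance (m₂ m₁ : ℝ) : SigmaFinite (contactMeasure m₂ m₁) := by
  unfold contactMeasure; infer_instance

theorem continuous_act : Continuous fun p : SO3 × E3 => act p.1 p.2 := by
  refine (PiLp.continuous_toLp 2 _).comp ?_
  exact (continuous_subtype_val.comp continuous_fst).matrix_mulVec
    ((PiLp.continuous_ofLp 2 _).comp continuous_snd)

theorem measurable_SE3_comp : Measurable fun p : SE3 × SE3 => p.1.comp p.2 := by
  have h1 : Continuous fun p : SE3 × SE3 => act p.1.2 p.2.1 :=
    continuous_act.comp (f := fun p : SE3 × SE3 => (p.1.2, p.2.1)) (by fun_prop)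
  have h2 : Continuous fun p : SE3 × SE3 => p.1.2 * p.2.2 :=
    continuous_mul.comp (f := fun p : SE3 × SE3 => (p.1.2, p.2.2)) (by fun_prop)
  have h3 : Continuous fun p : SE3 × SE3 => p.1.comp p.2 :=
    ((continuous_fst.comp continuous_fst).add h1).prodMk h2
  exact h3.measurable

theorem measurable_SE3_inv : Measurable SE3.inv := by
  have h0 : Continuous fun x : SE3 => x.2⁻¹ := continuous_inv.comp continuous_snd
  have h1 : Continuous fun x : SE3 => act x.2⁻¹ x.1 := continuous_act.comp (h0.prodMk continuous_fst)
  have h3 : Continuous SE3.inv := h1.neg.prodMk h0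
  exact h3.measurable

theorem measurePreserving_comp_left (g : SE3) (m : ℝ) :
    MeasurePreserving (fun x => g.comp x) (poseMeasure m) (poseMeasure m) :=
  ((measurePreserving_add_left volume g.1).comp (actIsometry g.2).measurePreserving).prod
    (measurePreserving_mul_left (haarSO3 m) g.2)

/-- On the right, `(t, R)` goes to `(t + R g.1, R * g.2)`, so the translation depends on `R`. With
the factors swapped this is a skew product over right multiplication on `SO(3)`. -/
theorem measurePreserving_comp_right (g : SE3) (m : ℝ) :
    MeasurePreserving (fun x : SE3 => x.comp g) (poseMeasure m) (poseMeasure m) := by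
  have h := (measurePreserving_mul_right_haarSO3 m g.2).skew_product
    (μc := (volume : Measure E3)) (μd := (volume : Measure E3))
    (g := fun R t => t + act R g.1) (by
      have : Measurable fun p : SO3 × E3 => act p.1 g.1 :=
        (continuous_act.comp (f := fun p : SO3 × E3 => (p.1, g.1)) (by fun_prop)).measurable
      exact measurable_snd.add this)
    (ae_of_all _ fun R => (measurePreserving_add_right volume (act R g.1)).map_eq)
  exact (Measure.measurePreserving_swap.comp h).comp Measure.measurePreserving_swap

/-! ### The conversion between poses and contact parameters -/

theorem measurePreserving_coords :
    MeasurePreserving (fun t : E3 => (t 0, t 1, t 2)) volume volume :=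
  (((MeasurePreserving.id volume).prod (volume_preserving_finTwoArrow ℝ)).comp
    (volume_preserving_piFinSuccAbove (fun _ : Fin 3 => ℝ) 0)).comp
      (PiLp.volume_preserving_ofLp (Fin 3))

theorem measurable_ofCoords : Measurable fun c : ℝ × ℝ × ℝ => (!₂[c.1, c.2.1, c.2.2] : E3) := by
  refine Continuous.measurable ((PiLp.continuous_toLp 2 _).comp (continuous_pi fun i => ?_))
  fin_cases i <;> simp <;> fun_prop

theorem measurePreserving_ofCoords :
    MeasurePreserving (fun c : ℝ × ℝ × ℝ => (!₂[c.1, c.2.1, c.2.2] : E3)) volume volume := by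
  have h := measurePreserving_coords
  rw [← one_smul ℝ≥0∞ (volume : Measure (ℝ × ℝ × ℝ))] at h
  have h1 := measurePreserving_of_leftInverse (l := 1) h measurable_ofCoords
    (ae_of_all _ fun t => PiLp.ext fun i => by fin_cases i <;> simp) (one_mul 1)
  rwa [one_smul] at h1

theorem measurePreserving_xi {m₀ m₂ m₁ : ℝ} (h₀ : 0 < m₀) (h₂ : 0 < m₂) (h₁ : 0 < m₁) :
    MeasurePreserving xi (poseMeasure m₀)
      (ENNReal.ofReal (m₀ / (m₂ * m₁)) • contactMeasure m₂ m₁) := by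
  have h := measurePreserving_coords.prod (measurePreserving_hopfCoord h₀ h₂ h₁)
  rw [Measure.prod_smul_right] at h
  exact h

theorem measurePreserving_xiInv {m₀ m₂ m₁ : ℝ} (h₀ : 0 < m₀) (h₂ : 0 < m₂) (h₁ : 0 < m₁) :
    MeasurePreserving xiInv (contactMeasure m₂ m₁)
      (ENNReal.ofReal (m₂ * m₁ / m₀) • poseMeasure m₀) := by
  have h := measurePreserving_ofCoords.prod (measurePreserving_hopfRot h₀ h₂ h₁)
  rw [Measure.prod_smul_right] at h
  exact h

theorem measurable_xi : Measurable xi := (measurePreserving_xi one_pos one_pos one_pos).measurable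

theorem measurable_xiInv : Measurable xiInv :=
  (measurePreserving_xiInv one_pos one_pos one_pos).measurable

/-! ### Densities on disjoint unions -/

instance {X Y : Type*} [MeasurableSpace X] [MeasurableSpace Y] (μ : Measure X) (ν : Measure Y)
    [SigmaFinite μ] [SigmaFinite ν] : SigmaFinite (sumMeasure μ ν) := by
  have hl : MeasurableEmbedding (Sum.inl : X → X ⊕ Y) :=
    ⟨Sum.inl_injective, measurable_inl, fun _ hs => measurableSet_inl_image.2 hs⟩
  have hr : MeasurableEmbedding (Sum.inr : Y → X ⊕ Y) :=
    ⟨Sum.inr_injective, measurable_inr, fun _ hs => measurableSet_inr_image.2 hs⟩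
  have := hl.sigmaFinite_map (μ := μ)
  have := hr.sigmaFinite_map (μ := ν)
  unfold sumMeasure; infer_instance

theorem sumMeasure_withDensity {X Y : Type*} [MeasurableSpace X] [MeasurableSpace Y]
    (μ : Measure X) (ν : Measure Y) (a b : ℝ≥0∞) :
    (sumMeasure μ ν).withDensity (Sum.elim (fun _ => a) fun _ => b) =
      sumMeasure (a • μ) (b • ν) := by
  have hm : Measurable (Sum.elim (fun _ => a) fun _ => b : X ⊕ Y → ℝ≥0∞) :=
    measurable_const.sumElim measurable_const
  have h1 : (Sum.elim (fun _ => a) fun _ => b : X ⊕ Y → ℝ≥0∞) =ᵐ[μ.map Sum.inl] fun _ => a :=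
    (ae_map_iff measurable_inl.aemeasurable (measurableSet_eq_fun hm measurable_const)).2
      (ae_of_all _ fun _ => rfl)
  have h2 : (Sum.elim (fun _ => a) fun _ => b : X ⊕ Y → ℝ≥0∞) =ᵐ[ν.map Sum.inr] fun _ => b :=
    (ae_map_iff measurable_inr.aemeasurable (measurableSet_eq_fun hm measurable_const)).2
      (ae_of_all _ fun _ => rfl)
  rw [sumMeasure, withDensity_add_measure, withDensity_congr_ae h1, withDensity_congr_ae h2,
    withDensity_const, withDensity_const, sumMeasure, Measure.map_smul, Measure.map_smul]

/-- The mass that arrives in `X` was sent by `g` from `Y`, and conversely. Hence the density on each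
part is the factor of the map that starts in the other part. -/
theorem sumMeasure_map_swap {X Y : Type*} [MeasurableSpace X] [MeasurableSpace Y]
    {μ : Measure X} {ν : Measure Y} {f : X → Y} {g : Y → X} {a b : ℝ≥0∞}
    (hf : MeasurePreserving f μ (b • ν)) (hg : MeasurePreserving g ν (a • μ)) :
    (sumMeasure μ ν).map (Sum.elim (fun x => Sum.inr (f x)) fun y => Sum.inl (g y)) =
      sumMeasure (a • μ) (b • ν) := by
  have h1 := measurable_inr (α := X).comp hf.measurable
  have h2 := measurable_inl (β := Y).comp hg.measurable
  have hm : Measurable (Sum.elim (fun x => Sum.inr (f x)) fun y => Sum.inl (g y) :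
    X ⊕ Y → X ⊕ Y) := h1.sumElim h2
  rw [sumMeasure, Measure.map_add _ _ hm, Measure.map_map hm measurable_inl,
    Measure.map_map hm measurable_inr, sumMeasure, add_comm, ← hf.map_eq, ← hg.map_eq,
    Measure.map_map measurable_inr hf.measurable, Measure.map_map measurable_inl hg.measurable]
  rfl

theorem rnDeriv_of_map_eq_withDensity {X : Type*} [MeasurableSpace X] {μ : Measure X}
    [SigmaFinite μ] {h : X → X} {ρ : X → ℝ≥0∞} (hρ : Measurable ρ)
    (he : μ.map h = μ.withDensity ρ) :
    μ.map h ≪ μ ∧ ∀ᵐ s ∂μ, (μ.map h).rnDeriv μ s = ρ s := by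
  rw [he]
  exact ⟨withDensity_absolutelyContinuous _ _, Measure.rnDeriv_withDensity μ hρ⟩

theorem density_sum_swap {X Y : Type*} [MeasurableSpace X] [MeasurableSpace Y]
    {μ : Measure X} {ν : Measure Y} [SigmaFinite μ] [SigmaFinite ν] {f : X → Y} {g : Y → X}
    {a b : ℝ≥0∞} (hf : MeasurePreserving f μ (b • ν)) (hg : MeasurePreserving g ν (a • μ))
    {h : X ⊕ Y → X ⊕ Y} (hh : h = Sum.elim (fun x => Sum.inr (f x)) fun y => Sum.inl (g y)) :
    AEMeasurable h (sumMeasure μ ν) ∧ (sumMeasure μ ν).map h ≪ sumMeasure μ ν ∧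
      ∀ᵐ s ∂(sumMeasure μ ν), ((sumMeasure μ ν).map h).rnDeriv (sumMeasure μ ν) s =
        Sum.elim (fun _ => a) (fun _ => b) s := by
  subst hh
  refine ⟨Measurable.aemeasurable (Measurable.sumElim (measurable_inr.comp hf.measurable)
    (measurable_inl.comp hg.measurable)), ?_⟩
  refine rnDeriv_of_map_eq_withDensity (measurable_const.sumElim measurable_const) ?_
  rw [sumMeasure_map_swap hf hg, sumMeasure_withDensity]

theorem sumMeasure_compl_union {X Y : Type*} [MeasurableSpace X] [MeasurableSpace Y]
    {μ : Measure X} {ν : Measure Y} {s : Set X} {t : Set Y} (hs : MeasurableSet s)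
    (ht : MeasurableSet t) (h : μ sᶜ = 0) (h' : ν tᶜ = 0) :
    sumMeasure μ ν (Sum.inl '' s ∪ Sum.inr '' t)ᶜ = 0 := by
  have hm : MeasurableSet (Sum.inl '' s ∪ Sum.inr '' t : Set (X ⊕ Y))ᶜ :=
    ((measurableSet_inl_image.2 hs).union (measurableSet_inr_image.2 ht)).compl
  have h1 : (Sum.inl ⁻¹' (Sum.inl '' s ∪ Sum.inr '' t : Set (X ⊕ Y))ᶜ) = sᶜ := by
    ext; simp
  have h2 : (Sum.inr ⁻¹' (Sum.inl '' s ∪ Sum.inr '' t : Set (X ⊕ Y))ᶜ) = tᶜ := by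
    ext; simp
  rw [sumMeasure, Measure.add_apply, Measure.map_apply measurable_inl hm,
    Measure.map_apply measurable_inr hm, h1, h2, h, h', add_zero]

theorem prod_preimage_snd_compl {X Y : Type*} [MeasurableSpace X] [MeasurableSpace Y]
    (μ : Measure X) {ν : Measure Y} [SFinite ν] {s : Set Y} (h : ν sᶜ = 0) :
    μ.prod ν {p | p.2 ∈ s}ᶜ = 0 := by
  have : {p : X × Y | p.2 ∈ s}ᶜ = univ ×ˢ sᶜ := by ext; simp
  rw [this, Measure.prod_prod, h, mul_zero]

/-! ### Domains of full measure and the densities of the three conversions. -/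

theorem hopfMeasure_hopfDomain_compl (m₂ m₁ : ℝ) : hopfMeasure m₂ m₁ hopfDomainᶜ = 0 :=
  ae_mem_hopfDomain m₂ m₁

theorem haarSO3_rotDomain_compl {m₀ : ℝ} (h₀ : 0 < m₀) : haarSO3 m₀ rotDomainᶜ = 0 :=
  ae_mem_rotDomain h₀

theorem baseMeasure_ellDomain_compl {m₀ : ℝ} (m₂ m₁ : ℝ) (h₀ : 0 < m₀) :
    baseMeasure m₀ m₂ m₁ ellDomainᶜ = 0 :=
  sumMeasure_compl_union (measurable_snd isOpen_rotDomain.measurableSet)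
    (measurable_snd isOpen_hopfDomain.measurableSet)
    (prod_preimage_snd_compl _ (haarSO3_rotDomain_compl h₀))
    (prod_preimage_snd_compl _ (hopfMeasure_hopfDomain_compl m₂ m₁))

theorem density_ellStar {m₀ m₂ m₁ : ℝ} (h₀ : 0 < m₀) (h₂ : 0 < m₂) (h₁ : 0 < m₁) :
    AEMeasurable ellStar (baseMeasureStar m₀ m₂ m₁) ∧
      (baseMeasureStar m₀ m₂ m₁).map ellStar ≪ baseMeasureStar m₀ m₂ m₁ ∧
      ∀ᵐ s ∂(baseMeasureStar m₀ m₂ m₁),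
        ((baseMeasureStar m₀ m₂ m₁).map ellStar).rnDeriv (baseMeasureStar m₀ m₂ m₁) s =
          Sum.elim (fun _ => ENNReal.ofReal (m₂ * m₁ / m₀))
            (fun _ => ENNReal.ofReal (m₀ / (m₂ * m₁))) s :=
  density_sum_swap (measurePreserving_hopfCoord h₀ h₂ h₁) (measurePreserving_hopfRot h₀ h₂ h₁) rfl

theorem density_ell {m₀ m₂ m₁ : ℝ} (h₀ : 0 < m₀) (h₂ : 0 < m₂) (h₁ : 0 < m₁) :
    AEMeasurable ell (baseMeasure m₀ m₂ m₁) ∧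
      (baseMeasure m₀ m₂ m₁).map ell ≪ baseMeasure m₀ m₂ m₁ ∧
      ∀ᵐ s ∂(baseMeasure m₀ m₂ m₁),
        ((baseMeasure m₀ m₂ m₁).map ell).rnDeriv (baseMeasure m₀ m₂ m₁) s =
          Sum.elim (fun _ => ENNReal.ofReal (m₂ * m₁ / m₀))
            (fun _ => ENNReal.ofReal (m₀ / (m₂ * m₁))) s :=
  density_sum_swap (measurePreserving_xi h₀ h₂ h₁) (measurePreserving_xiInv h₀ h₂ h₁) rfl

theorem measurePreserving_toContact {m₀ m₂ m₁ : ℝ} (h₀ : 0 < m₀) (h₂ : 0 < m₂) (h₁ : 0 < m₁)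
    (g₁ g₂ : SE3) :
    MeasurePreserving (fun x => xi ((g₁.comp x).comp g₂)) (poseMeasure m₀)
      (ENNReal.ofReal (m₀ / (m₂ * m₁)) • contactMeasure m₂ m₁) :=
  (measurePreserving_xi h₀ h₂ h₁).comp
    ((measurePreserving_comp_right g₂ m₀).comp (measurePreserving_comp_left g₁ m₀))

theorem measurePreserving_ofContact {m₀ m₂ m₁ : ℝ} (h₀ : 0 < m₀) (h₂ : 0 < m₂) (h₁ : 0 < m₁)
    (g₁ g₂ : SE3) :
    MeasurePreserving (fun y => (g₁.comp (xiInv y)).comp g₂) (contactMeasure m₂ m₁)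
      (ENNReal.ofReal (m₂ * m₁ / m₀) • poseMeasure m₀) :=
  ((measurePreserving_comp_right g₂ m₀).smul_measure _).comp
    (((measurePreserving_comp_left g₁ m₀).smul_measure _).comp (measurePreserving_xiInv h₀ h₂ h₁))

theorem density_ellAbs {m₀ m₂ m₁ : ℝ} (h₀ : 0 < m₀) (h₂ : 0 < m₂) (h₁ : 0 < m₁) (g₁ g₂ : SE3) :
    AEMeasurable (ellAbs g₁ g₂) (baseMeasure m₀ m₂ m₁) ∧
      (baseMeasure m₀ m₂ m₁).map (ellAbs g₁ g₂) ≪ baseMeasure m₀ m₂ m₁ ∧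
      ∀ᵐ s ∂(baseMeasure m₀ m₂ m₁),
        ((baseMeasure m₀ m₂ m₁).map (ellAbs g₁ g₂)).rnDeriv (baseMeasure m₀ m₂ m₁) s =
          Sum.elim (fun _ => ENNReal.ofReal (m₂ * m₁ / m₀))
            (fun _ => ENNReal.ofReal (m₀ / (m₂ * m₁))) s :=
  density_sum_swap (measurePreserving_toContact h₀ h₂ h₁ g₁.inv g₂.inv)
    (measurePreserving_ofContact h₀ h₂ h₁ g₁ g₂) rfl

theorem ofReal_mass_ratio :
    ENNReal.ofReal (4 * Real.pi * (2 * Real.pi) / Real.pi ^ 2) = 8 := by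
  have : 4 * Real.pi * (2 * Real.pi) / Real.pi ^ 2 = 8 := by
    have := Real.pi_ne_zero
    field_simp
    norm_num
  rw [this]
  norm_num

theorem ofReal_mass_ratio_inv :
    ENNReal.ofReal (Real.pi ^ 2 / (4 * Real.pi * (2 * Real.pi))) = 1 / 8 := by
  rw [← inv_div, ENNReal.ofReal_inv_of_pos (by positivity), ofReal_mass_ratio, one_div]

/-! ### Changing one coordinate in a product measure -/

theorem lmarginal_congr_measure {ι : Type*} [DecidableEq ι] {X : ι → Type*}
    [∀ i, MeasurableSpace (X i)] {μ μ' : ∀ i, Measure (X i)} {s : Finset ι}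
    (h : ∀ i ∈ s, μ i = μ' i) (f : (∀ i, X i) → ℝ≥0∞) :
    lmarginal μ s f = lmarginal μ' s f := by
  funext x
  unfold lmarginal
  have : (fun i : s => μ i) = fun i : s => μ' i := funext fun i => h i i.2
  rw [this]

theorem lintegral_pi_eq_lmarginal_erase {ι : Type*} [Fintype ι] [DecidableEq ι] {X : ι → Type*}
    [∀ i, MeasurableSpace (X i)] (μ : ∀ i, Measure (X i)) [∀ i, SigmaFinite (μ i)] (v : ι)
    {f : (∀ i, X i) → ℝ≥0∞} (hf : Measurable f) (x : ∀ i, X i) :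
    ∫⁻ θ, f θ ∂(Measure.pi μ) =
      lmarginal μ (Finset.univ.erase v) (fun θ => ∫⁻ a, f (Function.update θ v a) ∂(μ v)) x := by
  rw [← lmarginal_erase' (μ := μ) f hf (Finset.mem_univ v), lmarginal_univ]

/-- Fubini: integrate over the coordinate `v` first. `C` may depend on all coordinates; what is
needed is that for each choice of the others it sends `μ v` to the same multiple of `μ' v`. -/
theorem pi_map_update {ι : Type*} [Fintype ι] [DecidableEq ι] {X : ι → Type*}
    [∀ i, MeasurableSpace (X i)] (μ μ' : ∀ i, Measure (X i)) [∀ i, SigmaFinite (μ i)]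
    [∀ i, SigmaFinite (μ' i)] {v : ι} (hμ : ∀ i, i ≠ v → μ i = μ' i)
    {C : (∀ i, X i) → X v} (hC : Measurable C) {c : ℝ≥0∞}
    (h : ∀ θ, (μ v).map (fun a => C (Function.update θ v a)) = c • μ' v) :
    (Measure.pi μ).map (fun θ => Function.update θ v (C θ)) = c • Measure.pi μ' := by
  -- The marginal integrals are functions on the product, so a point at which to evaluate them is
  -- required; on an empty product all measures vanish.
  rcases isEmpty_or_nonempty (∀ i, X i) with hE | ⟨⟨x⟩⟩
  · rw [Measure.eq_zero_of_isEmpty (Measure.map _ _), Measure.eq_zero_of_isEmpty (c • _)]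
  have hU : Measurable fun θ : ∀ i, X i => Function.update θ v (C θ) :=
    measurable_update'.comp (measurable_id.prodMk hC)
  refine Measure.ext_of_lintegral _ fun f hf => ?_
  rw [lintegral_map hf hU, lintegral_smul_measure,
    lintegral_pi_eq_lmarginal_erase μ v (f := fun θ => f (Function.update θ v (C θ)))
      (hf.comp hU) x,
    lintegral_pi_eq_lmarginal_erase μ' v hf x,
    lmarginal_congr_measure (μ' := μ') fun i hi => hμ i (Finset.ne_of_mem_erase hi)]
  have e : ∀ θ, ∫⁻ a, f (Function.update (Function.update θ v a) v
      (C (Function.update θ v a))) ∂(μ v) = c * ∫⁻ a, f (Function.update θ v a) ∂(μ' v) := by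
    intro θ
    have hf' : Measurable fun a => f (Function.update θ v a) := hf.comp (measurable_update θ)
    have hC' : Measurable fun a => C (Function.update θ v a) := hC.comp (measurable_update θ)
    rw [← smul_eq_mul, ← lintegral_smul_measure, ← h θ, lintegral_map hf' hC']
    simp only [Function.update_idem]
  simp only [e]
  unfold lmarginal
  rw [lintegral_const_mul, smul_eq_mul]
  have h1 : Measurable fun θ : ∀ i, X i => ∫⁻ a, f (Function.update θ v a) ∂(μ' v) :=
    Measurable.lintegral_prod_right' (hf.comp measurable_update')
  exact h1.comp measurable_updateFinset

/-- The branches depend on the parameter `ω` as well, so `Ω × (A ⊕ B)` is split into `Ω × A` and `Ω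
× B`. -/
theorem measurable_sumElim_apply {Ω A B Y : Type*} [MeasurableSpace Ω] [MeasurableSpace A]
    [MeasurableSpace B] [MeasurableSpace Y] {F : Ω → A → Y} {G : Ω → B → Y} {a : Ω → A ⊕ B}
    (hF : Measurable (Function.uncurry F)) (hG : Measurable (Function.uncurry G))
    (ha : Measurable a) : Measurable fun ω => Sum.elim (F ω) (G ω) (a ω) := by
  have h := (hF.sumElim hG).comp ((MeasurableEquiv.prodSumDistrib Ω A B).measurable.comp
    (measurable_id.prodMk ha))
  convert h using 2 with ω
  rcases h : a ω with p | q <;> simp [h, MeasurableEquiv.prodSumDistrib] <;> rfl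

/-! ### Trees -/

namespace RootedTree

variable {N : ℕ}

theorem ext_par {G G' : RootedTree N} (h : G.par = G'.par) : G = G' := by
  cases G; cases G'; cases h; rfl

instance : Finite (RootedTree N) := Finite.of_injective RootedTree.par fun _ _ => ext_par

/-- A parent inside the subtree would close a directed cycle through `v`, contrary to
well-foundedness. -/
theorem not_inSubtree_parent (G : RootedTree N) {u v : Fin N} (h : G.par v = some u) :
    ¬ G.InSubtree v u := fun hs => by
  have h1 : Relation.TransGen (fun a b => G.par b = some a) v v :=
    Relation.TransGen.tail' hs h
  exact G.wf.transGen.irrefl.irrefl v h1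

theorem not_inSubtree_of_par (G : RootedTree N) {t u v : Fin N} (h : ¬ G.InSubtree v u)
    (ht : G.par u = some t) : ¬ G.InSubtree v t := fun hs => h (Relation.ReflTransGen.tail hs ht)

theorem ne_of_not_inSubtree (G : RootedTree N) {u v : Fin N} (h : ¬ G.InSubtree v u) : u ≠ v := by
  rintro rfl
  exact h Relation.ReflTransGen.refl

/-- Objects outside the subtree of `v` keep all their ancestors, so they still lead up to the root.
Then `v` does too, because its new parent is one of them or the root, and induction along the old
tree reaches all remaining objects. -/
theorem wellFounded_update (G : RootedTree N) (v : Fin N) {p : Option (Fin N)}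
    (hp : ∀ u, p = some u → ¬ G.InSubtree v u) :
    WellFounded fun u w => Function.update G.par v p w = some u := by
  have h1 : ∀ w, ¬ G.InSubtree v w →
      Acc (fun u w => Function.update G.par v p w = some u) w := by
    intro w
    induction w using G.wf.induction with
    | _ w ih =>
      intro hw
      refine ⟨_, fun u hu => ?_⟩
      rw [Function.update_of_ne (G.ne_of_not_inSubtree hw)] at hu
      exact ih u hu (G.not_inSubtree_of_par hw hu)
  have h2 : Acc (fun u w => Function.update G.par v p w = some u) v := by
    refine ⟨_, fun u hu => ?_⟩
    rw [Function.update_self] at hu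
    exact h1 u (hp u hu)
  refine ⟨fun w => ?_⟩
  induction w using G.wf.induction with
  | _ w ih =>
    by_cases hwv : w = v
    · rwa [hwv]
    · refine ⟨_, fun u hu => ?_⟩
      rw [Function.update_of_ne hwv] at hu
      exact ih u hu

theorem regraft_par (G : RootedTree N) (v : Fin N) {p : Option (Fin N)}
    (hp : ∀ u, p = some u → ¬ G.InSubtree v u) :
    (G.regraft v p).par = Function.update G.par v p := by
  rw [regraft, dif_pos (G.wellFounded_update v hp)]

/-- Only the edge into `v` has changed, so regrafting adds no descendants to `v`. This makes the
reverse move admissible. -/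
theorem inSubtree_of_regraft (G : RootedTree N) {v w : Fin N} {p : Option (Fin N)}
    (hp : ∀ u, p = some u → ¬ G.InSubtree v u) (h : (G.regraft v p).InSubtree v w) :
    G.InSubtree v w := by
  induction h with
  | refl => exact Relation.ReflTransGen.refl
  | @tail b c _ hbc ih =>
    rw [regraft_par G v hp] at hbc
    by_cases hc : c = v
    -- An edge ending at `v` is the changed one; the path from `v` is then restarted at its end.
    · rw [hc]; exact Relation.ReflTransGen.refl
    · rw [Function.update_of_ne hc] at hbc
      exact Relation.ReflTransGen.tail ih hbc

end RootedTree

/-! ### Absolute poses -/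

section absPose

variable {N K : ℕ} (face : Fin N → Fin K → SE3)

theorem absPose_eq_of_par_eq_none {x : Latent N K} {v : Fin N} (h : x.1.par v = none) :
    absPose face x v = Sum.elim (fun p => p) (fun _ => SE3.id) (x.2 v) := by
  rw [absPose, WellFounded.fix_eq]
  split
  · simp_all
  · simp_all
  · rcases hx : x.2 v with p | q <;> simp_all

theorem absPose_eq_of_par_eq_some {x : Latent N K} {u v : Fin N} (h : x.1.par v = some u) :
    absPose face x v = Sum.elim (fun _ => SE3.id)
      (fun q => (((absPose face x u).comp (face u q.2.1)).comp (xiInv q.2.2)).comp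
        (face v q.1).inv) (x.2 v) := by
  rw [absPose, WellFounded.fix_eq]
  split
  · simp_all
  · rename_i u' f f' y h1 h2
    obtain rfl : u = u' := by rw [h] at h1; exact Option.some.inj h1
    rw [h2]
    rfl
  · rename_i h1
    rcases hx : x.2 v with p | ⟨f, f', y⟩
    · rfl
    · exact (h1 u f f' y h hx).elim

/-- The pose of `u` is computed from the ancestors of `u`, and `v` is not among them or equal to
`u`. -/
theorem absPose_congr {x x' : Latent N K} {v : Fin N}
    (hp : ∀ w, w ≠ v → x'.1.par w = x.1.par w) (hθ : ∀ w, w ≠ v → x'.2 w = x.2 w) (u : Fin N) :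
    ¬ x.1.InSubtree v u → absPose face x' u = absPose face x u := by
  induction u using x.1.wf.induction with
  | _ u ih =>
    intro hu
    have hne := x.1.ne_of_not_inSubtree hu
    rcases h : x.1.par u with _ | t
    · rw [absPose_eq_of_par_eq_none face h,
        absPose_eq_of_par_eq_none face ((hp u hne).trans h), hθ u hne]
    · rw [absPose_eq_of_par_eq_some face h,
        absPose_eq_of_par_eq_some face ((hp u hne).trans h), hθ u hne,
        ih t h (x.1.not_inSubtree_of_par hu h)]

theorem measurable_absPose (G : RootedTree N) (u : Fin N) :
    Measurable fun θ : Fin N → Param K => absPose face (G, θ) u := by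
  induction u using G.wf.induction with
  | _ u ih =>
    rcases h : G.par u with _ | t
    · have e : (fun θ : Fin N → Param K => absPose face (G, θ) u) =
          fun θ => Sum.elim (fun p => p) (fun _ => SE3.id) (θ u) :=
        funext fun θ => absPose_eq_of_par_eq_none face (x := (G, θ)) h
      rw [e]
      exact (measurable_id.sumElim measurable_const).comp (measurable_pi_apply u)
    · have e : (fun θ : Fin N → Param K => absPose face (G, θ) u) =
          fun θ => Sum.elim (fun _ => SE3.id)
            (fun q => (((absPose face (G, θ) t).comp (face t q.2.1)).comp (xiInv q.2.2)).comp
              (face u q.1).inv) (θ u) :=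
        funext fun θ => absPose_eq_of_par_eq_some face (x := (G, θ)) h
      rw [e]
      refine measurable_sumElim_apply measurable_const ?_ (measurable_pi_apply u)
      have h1 : Measurable fun z : (Fin N → Param K) × (Fin K × Fin K × Contact) =>
          absPose face (G, z.1) t := (ih t h).comp measurable_fst
      have h2 : Measurable fun z : (Fin N → Param K) × (Fin K × Fin K × Contact) =>
          face t z.2.2.1 := (measurable_of_countable (face t)).comp (by fun_prop)
      have h3 : Measurable fun z : (Fin N → Param K) × (Fin K × Fin K × Contact) =>
          xiInv z.2.2.2 := measurable_xiInv.comp (by fun_prop)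
      have h4 : Measurable fun z : (Fin N → Param K) × (Fin K × Fin K × Contact) =>
          (face u z.2.1).inv :=
        measurable_SE3_inv.comp ((measurable_of_countable (face u)).comp (by fun_prop))
      exact measurable_SE3_comp.comp ((measurable_SE3_comp.comp
        ((measurable_SE3_comp.comp (h1.prodMk h2)).prodMk h3)).prodMk h4)

end absPose

/-! ### Parameters of one object and its absolute pose -/

/-- The place of an object in a scene graph: `none` for a floating object, `some (u, f, f')` for an
object whose face `f` touches the face `f'` of `u`. -/
abbrev Place (N K : ℕ) := Option (Fin N × Fin K × Fin K)

/-- The parameters of an object at a given place. -/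
def placeSet {N K : ℕ} : Place N K → Set (Param K)
  | none => range Sum.inl
  | some (_, f, f') => range fun y => Sum.inr (f, f', y)

/-- The auxiliary variable for moving `v` to a given place. -/
def placeAux {N K : ℕ} (v : Fin N) : Place N K → Aux N K
  | none => Sum.inl v
  | some (u, f, f') => Sum.inr (v, u, f, f')

section place

variable {N K : ℕ} (face : Fin N → Fin K → SE3)

/-- The absolute pose of the object `v` at a given place, in terms of its parameters and the
absolute poses `P` of the other objects. -/
noncomputable def toPose (P : Fin N → SE3) (v : Fin N) : Place N K → Param K → SE3
  | none => Sum.elim (fun p => p) fun _ => SE3.id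
  | some (u, f, f') => Sum.elim (fun _ => SE3.id) fun q =>
      (((P u).comp (face u f')).comp (xiInv q.2.2)).comp (face v f).inv

/-- The parameters of the object `v` at a given place, in terms of its absolute pose and the
absolute poses `P` of the other objects. -/
noncomputable def ofPose (P : Fin N → SE3) (v : Fin N) : Place N K → SE3 → Param K
  | none => Sum.inl
  | some (u, f, f') => fun x =>
      Sum.inr (f, f', xi (((P u).comp (face u f')).inv.comp (x.comp (face v f))))

theorem toPose_congr {P P' : Fin N → SE3} {v : Fin N} {l : Place N K}
    (h : ∀ t ∈ l, P t.1 = P' t.1) : toPose face P v l = toPose face P' v l := by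
  rcases l with _ | ⟨u, f, f'⟩
  · rfl
  · simp only [toPose, h _ rfl]

theorem ofPose_congr {P P' : Fin N → SE3} {v : Fin N} {l : Place N K}
    (h : ∀ t ∈ l, P t.1 = P' t.1) : ofPose face P v l = ofPose face P' v l := by
  rcases l with _ | ⟨u, f, f'⟩
  · rfl
  · simp only [ofPose, h _ rfl]

theorem measurable_toPose {Ω : Type*} [MeasurableSpace Ω] {P : Ω → Fin N → SE3}
    (hP : ∀ u, Measurable fun ω => P ω u) (v : Fin N) (l : Place N K) {a : Ω → Param K}
    (ha : Measurable a) : Measurable fun ω => toPose face (P ω) v l (a ω) := by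
  rcases l with _ | ⟨u, f, f'⟩
  · exact (measurable_id.sumElim measurable_const).comp ha
  · refine measurable_sumElim_apply measurable_const ?_ ha
    have h1 : Measurable fun z : Ω × (Fin K × Fin K × Contact) => P z.1 u :=
      (hP u).comp measurable_fst
    have h3 : Measurable fun z : Ω × (Fin K × Fin K × Contact) => xiInv z.2.2.2 :=
      measurable_xiInv.comp (by fun_prop)
    exact measurable_SE3_comp.comp ((measurable_SE3_comp.comp ((measurable_SE3_comp.comp
      (h1.prodMk measurable_const)).prodMk h3)).prodMk measurable_const)

theorem measurable_ofPose {Ω : Type*} [MeasurableSpace Ω] {P : Ω → Fin N → SE3}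
    (hP : ∀ u, Measurable fun ω => P ω u) (v : Fin N) (l : Place N K) {a : Ω → SE3}
    (ha : Measurable a) : Measurable fun ω => ofPose face (P ω) v l (a ω) := by
  rcases l with _ | ⟨u, f, f'⟩
  · exact measurable_inl.comp ha
  · refine measurable_inr.comp (measurable_const.prodMk (measurable_const.prodMk
      (measurable_xi.comp (measurable_SE3_comp.comp (Measurable.prodMk ?_ ?_)))))
    · exact measurable_SE3_inv.comp (measurable_SE3_comp.comp ((hP u).prodMk measurable_const))
    · exact measurable_SE3_comp.comp (ha.prodMk measurable_const)

theorem measurableSet_placeSet (l : Place N K) : MeasurableSet (placeSet l) := by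
  rcases l with _ | ⟨u, f, f'⟩
  · exact measurableSet_range_inl
  · have : placeSet (some (u, f, f')) =
        (Sum.inr '' ({f} ×ˢ ({f'} ×ˢ univ)) : Set (Param K)) := by
      ext q
      constructor
      · rintro ⟨y, rfl⟩
        exact ⟨(f, f', y), ⟨rfl, rfl, trivial⟩, rfl⟩
      · rintro ⟨⟨_, _, y⟩, ⟨rfl, rfl, -⟩, rfl⟩
        exact ⟨y, rfl⟩
    rw [this]
    exact measurableSet_inr_image.2 ((measurableSet_singleton f).prod
      ((measurableSet_singleton f').prod MeasurableSet.univ))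

instance (m₀ m₂ m₁ : ℝ) : SigmaFinite (paramMeasure K m₀ m₂ m₁) := by
  unfold paramMeasure; infer_instance

theorem paramMeasure_restrict_none (m₀ m₂ m₁ : ℝ) :
    (paramMeasure K m₀ m₂ m₁).restrict (placeSet (none : Place N K)) =
      (poseMeasure m₀).map Sum.inl := by
  have hm := measurableSet_placeSet (none : Place N K)
  have h1 : Sum.inl ⁻¹' (placeSet (none : Place N K)) = univ := by ext; simp [placeSet]
  have h2 : Sum.inr ⁻¹' (placeSet (none : Place N K)) = ∅ := by ext; simp [placeSet]
  rw [paramMeasure, sumMeasure, Measure.restrict_add, Measure.restrict_map measurable_inl hm,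
    Measure.restrict_map measurable_inr hm, h1, h2, Measure.restrict_univ,
    Measure.restrict_empty, Measure.map_zero, add_zero]

theorem count_restrict_singleton {X : Type*} [MeasurableSpace X] [MeasurableSingletonClass X]
    (a : X) : (Measure.count : Measure X).restrict {a} = Measure.dirac a := by
  rw [Measure.restrict_singleton, Measure.count_singleton, one_smul]

theorem paramMeasure_restrict_some (m₀ m₂ m₁ : ℝ) (u : Fin N) (f f' : Fin K) :
    (paramMeasure K m₀ m₂ m₁).restrict (placeSet (some (u, f, f'))) =
      (contactMeasure m₂ m₁).map fun y => Sum.inr (f, f', y) := by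
  have hm := measurableSet_placeSet (some (u, f, f') : Place N K)
  have h1 : Sum.inl ⁻¹' (placeSet (some (u, f, f'))) = (∅ : Set SE3) := by ext; simp [placeSet]
  have h2 : Sum.inr ⁻¹' (placeSet (some (u, f, f'))) =
      ({f} ×ˢ ({f'} ×ˢ univ) : Set (Fin K × Fin K × Contact)) := by
    ext ⟨a, b, c⟩
    simp only [placeSet, mem_preimage, mem_range, Sum.inr.injEq, Prod.mk.injEq, mem_prod,
      mem_singleton_iff, mem_univ, and_true]
    exact ⟨fun ⟨y, h, h', _⟩ => ⟨h.symm, h'.symm⟩, fun ⟨h, h'⟩ => ⟨c, h.symm, h'.symm, rfl⟩⟩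
  rw [paramMeasure, sumMeasure, Measure.restrict_add, Measure.restrict_map measurable_inl hm,
    Measure.restrict_map measurable_inr hm, h1, h2, Measure.restrict_empty, Measure.map_zero,
    zero_add, ← Measure.prod_restrict, ← Measure.prod_restrict, Measure.restrict_univ,
    count_restrict_singleton, count_restrict_singleton, Measure.dirac_prod, Measure.dirac_prod,
    Measure.map_map measurable_prodMk_left measurable_prodMk_left,
    Measure.map_map measurable_inr (measurable_prodMk_left.comp measurable_prodMk_left)]
  rfl

/-- The factor between the measure on the parameters at a place and the measure on poses. -/
noncomputable def placeMass (m₀ m₂ m₁ : ℝ) : Place N K → ℝ≥0∞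
  | none => 1
  | some _ => ENNReal.ofReal (m₂ * m₁ / m₀)

/-- The inverse of `placeMass`. -/
noncomputable def placeMassInv (m₀ m₂ m₁ : ℝ) : Place N K → ℝ≥0∞
  | none => 1
  | some _ => ENNReal.ofReal (m₀ / (m₂ * m₁))

variable {m₀ m₂ m₁ : ℝ}

theorem map_toPose (h₀ : 0 < m₀) (h₂ : 0 < m₂) (h₁ : 0 < m₁) (P : Fin N → SE3) (v : Fin N)
    (l : Place N K) :
    ((paramMeasure K m₀ m₂ m₁).restrict (placeSet l)).map (toPose face P v l) =
      placeMass m₀ m₂ m₁ l • poseMeasure m₀ := by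
  have hm : Measurable (toPose face P v l) :=
    measurable_toPose face (P := fun _ : Param K => P) (fun _ => measurable_const) v l
      measurable_id
  rcases l with _ | ⟨u, f, f'⟩
  · rw [paramMeasure_restrict_none, Measure.map_map hm measurable_inl, placeMass, one_smul]
    exact Measure.map_id
  · have he : Measurable fun y : Contact => (Sum.inr (f, f', y) : Param K) :=
      measurable_inr.comp (measurable_prodMk_left.comp measurable_prodMk_left)
    rw [paramMeasure_restrict_some, Measure.map_map hm he]
    exact (measurePreserving_ofContact h₀ h₂ h₁ _ _).map_eq

theorem map_ofPose (h₀ : 0 < m₀) (h₂ : 0 < m₂) (h₁ : 0 < m₁) (P : Fin N → SE3) (v : Fin N)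
    (l : Place N K) :
    (poseMeasure m₀).map (ofPose face P v l) =
      placeMassInv m₀ m₂ m₁ l • (paramMeasure K m₀ m₂ m₁).restrict (placeSet l) := by
  rcases l with _ | ⟨u, f, f'⟩
  · rw [paramMeasure_restrict_none, placeMassInv, one_smul]
    rfl
  · have he : Measurable fun y : Contact => (Sum.inr (f, f', y) : Param K) :=
      measurable_inr.comp (measurable_prodMk_left.comp measurable_prodMk_left)
    have h := (measurePreserving_xi h₀ h₂ h₁).comp
      ((measurePreserving_comp_left ((P u).comp (face u f')).inv m₀).comp
        (measurePreserving_comp_right (face v f) m₀))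
    rw [paramMeasure_restrict_some, placeMassInv, ← Measure.map_smul, ← h.map_eq,
      Measure.map_map he h.measurable]
    rfl

/-- The change of place factors through the absolute pose. The measure on poses does not depend on
the place, so the two scaling factors multiply. -/
theorem map_ofPose_toPose (h₀ : 0 < m₀) (h₂ : 0 < m₂) (h₁ : 0 < m₁) (P : Fin N → SE3)
    (v : Fin N) (l l' : Place N K) :
    ((paramMeasure K m₀ m₂ m₁).restrict (placeSet l)).map
        (fun a => ofPose face P v l' (toPose face P v l a)) =
      (placeMass m₀ m₂ m₁ l * placeMassInv m₀ m₂ m₁ l') •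
        (paramMeasure K m₀ m₂ m₁).restrict (placeSet l') := by
  have hm : Measurable (toPose face P v l) :=
    measurable_toPose face (P := fun _ : Param K => P) (fun _ => measurable_const) v l
      measurable_id
  have hm' : Measurable (ofPose face P v l') :=
    measurable_ofPose face (P := fun _ : SE3 => P) (fun _ => measurable_const) v l'
      measurable_id
  have h := map_toPose face h₀ h₂ h₁ P v l
  have h' := map_ofPose face h₀ h₂ h₁ P v l'
  rw [mul_smul, ← h', ← Measure.map_smul, ← h, Measure.map_map hm' hm]
  rfl

end place

/-! ### Cells of the extended state space -/

instance {X Y : Type*} [MeasurableSpace X] [MeasurableSpace Y] [MeasurableSingletonClass X]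
    [MeasurableSingletonClass Y] : MeasurableSingletonClass (X ⊕ Y) where
  measurableSet_singleton
    | Sum.inl x => by
      rw [← image_singleton]
      exact measurableSet_inl_image.2 (measurableSet_singleton x)
    | Sum.inr y => by
      rw [← image_singleton]
      exact measurableSet_inr_image.2 (measurableSet_singleton y)

theorem placeAux_injective {N K : ℕ} {v v' : Fin N} {l l' : Place N K}
    (h : placeAux v l = placeAux v' l') : v = v' ∧ l = l' := by
  rcases l with _ | ⟨u, f, f'⟩ <;> rcases l' with _ | ⟨u', g, g'⟩ <;>
    simp_all [placeAux]

/-- A way of moving an object `obj` in a tree from the place `src` to the place `tgt`. -/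
structure Graft (N K : ℕ) where
  /-- The tree before the move. -/
  tree : RootedTree N
  /-- The moved object. -/
  obj : Fin N
  /-- The place of the object before the move. -/
  src : Place N K
  /-- The place of the object after the move. -/
  tgt : Place N K
  par_obj : tree.par obj = src.map Prod.fst
  not_inSubtree : ∀ t ∈ tgt, ¬ tree.InSubtree obj t.1

namespace Graft

variable {N K : ℕ}

theorem ext_data {τ τ' : Graft N K} (h1 : τ.tree = τ'.tree) (h2 : τ.obj = τ'.obj)
    (h3 : τ.src = τ'.src) (h4 : τ.tgt = τ'.tgt) : τ = τ' := by
  cases τ; cases τ'; cases h1; cases h2; cases h3; cases h4; rfl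

instance : Finite (Graft N K) :=
  Finite.of_injective (fun τ : Graft N K => (τ.tree, τ.obj, τ.src, τ.tgt)) fun τ τ' h => by
    simp only [Prod.mk.injEq] at h
    exact ext_data h.1 h.2.1 h.2.2.1 h.2.2.2

theorem not_inSubtree_map (τ : Graft N K) (u : Fin N) (h : τ.tgt.map Prod.fst = some u) :
    ¬ τ.tree.InSubtree τ.obj u := by
  obtain ⟨t, ht, rfl⟩ := Option.map_eq_some_iff.1 h
  exact τ.not_inSubtree t ht

theorem not_inSubtree_src (τ : Graft N K) (t) (h : t ∈ τ.src) :
    ¬ τ.tree.InSubtree τ.obj t.1 := by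
  refine τ.tree.not_inSubtree_parent ?_
  rw [τ.par_obj, Option.mem_def.1 h]
  rfl

/-- The reverse move. -/
noncomputable def rev (τ : Graft N K) : Graft N K where
  tree := τ.tree.regraft τ.obj (τ.tgt.map Prod.fst)
  obj := τ.obj
  src := τ.tgt
  tgt := τ.src
  par_obj := by
    rw [τ.tree.regraft_par _ τ.not_inSubtree_map, Function.update_self]
  not_inSubtree t ht hs :=
    τ.not_inSubtree_src t ht (τ.tree.inSubtree_of_regraft τ.not_inSubtree_map hs)

theorem rev_tree_par (τ : Graft N K) :
    τ.rev.tree.par = Function.update τ.tree.par τ.obj (τ.tgt.map Prod.fst) :=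
  τ.tree.regraft_par _ τ.not_inSubtree_map

theorem rev_rev (τ : Graft N K) : τ.rev.rev = τ := by
  refine ext_data (RootedTree.ext_par ?_) rfl rfl rfl
  rw [rev_tree_par, rev_tree_par]
  change Function.update (Function.update τ.tree.par τ.obj _) τ.obj (τ.src.map Prod.fst) = _
  rw [Function.update_idem, ← τ.par_obj, Function.update_eq_self]

/-- Reversal of moves as a permutation. -/
noncomputable def revEquiv : Graft N K ≃ Graft N K := ⟨rev, rev, rev_rev, rev_rev⟩

/-- The parameters of the object `w` that are allowed before the move. -/
def paramSet (τ : Graft N K) (w : Fin N) : Set (Param K) :=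
  if w = τ.obj then placeSet τ.src else {a | a.isLeft = true ↔ τ.tree.par w = none}

/-- The extended states that correspond to the move. -/
def cell (τ : Graft N K) : Set (Latent N K × Aux N K) :=
  ({τ.tree} ×ˢ univ.pi τ.paramSet) ×ˢ {placeAux τ.obj τ.tgt}

theorem mem_cell {τ : Graft N K} {s : Latent N K × Aux N K} :
    s ∈ τ.cell ↔ s.1.1 = τ.tree ∧ s.2 = placeAux τ.obj τ.tgt ∧ s.1.2 τ.obj ∈ placeSet τ.src ∧
      ∀ w, w ≠ τ.obj → ((s.1.2 w).isLeft = true ↔ τ.tree.par w = none) := by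
  simp only [cell, mem_prod, mem_singleton_iff, mem_univ_pi, paramSet]
  constructor
  · rintro ⟨⟨h1, h2⟩, h3⟩
    refine ⟨h1, h3, by simpa using h2 τ.obj, fun w hw => ?_⟩
    have := h2 w
    rwa [if_neg hw] at this
  · rintro ⟨h1, h3, h4, h5⟩
    refine ⟨⟨h1, fun w => ?_⟩, h3⟩
    split_ifs with hw
    · rw [hw]; exact h4
    · exact h5 w hw

theorem isLeft_iff_of_mem_placeSet {l : Place N K} {a : Param K} (h : a ∈ placeSet l) :
    a.isLeft = true ↔ l.map Prod.fst = none := by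
  rcases l with _ | ⟨u, f, f'⟩
  · obtain ⟨p, rfl⟩ := h; simp
  · obtain ⟨p, rfl⟩ := h; simp

theorem cell_subset (τ : Graft N K) : τ.cell ⊆ stateSpace N K := by
  intro s hs
  obtain ⟨h1, h2, h3, h4⟩ := mem_cell.1 hs
  refine ⟨fun w => ?_, fun v u f f' h => ?_⟩
  · rw [h1]
    by_cases hw : w = τ.obj
    · rw [hw, τ.par_obj]
      exact isLeft_iff_of_mem_placeSet h3
    · exact h4 w hw
  · rw [h1]
    have h5 : placeAux τ.obj τ.tgt = placeAux v (some (u, f, f')) := h2.symm.trans h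
    obtain ⟨rfl, h6⟩ := placeAux_injective h5
    exact τ.not_inSubtree _ h6

theorem exists_place (s : Latent N K) (hs : s ∈ latentSpace N K) (v : Fin N) :
    ∃ l : Place N K, s.1.par v = l.map Prod.fst ∧ s.2 v ∈ placeSet l := by
  have h := hs v
  rcases hp : s.1.par v with _ | u <;> rcases ha : s.2 v with p | ⟨f, f', y⟩
  · exact ⟨none, rfl, p, rfl⟩
  · rw [hp, ha] at h; simp at h
  · rw [hp, ha] at h; simp at h
  · exact ⟨some (u, f, f'), rfl, y, rfl⟩

theorem exists_mem_cell {s : Latent N K × Aux N K} (hs : s ∈ stateSpace N K) :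
    ∃ τ : Graft N K, s ∈ τ.cell := by
  obtain ⟨v, l', hl'⟩ : ∃ v, ∃ l' : Place N K, s.2 = placeAux v l' := by
    rcases h : s.2 with v | ⟨v, u, f, f'⟩
    · exact ⟨v, none, rfl⟩
    · exact ⟨v, some (u, f, f'), rfl⟩
  obtain ⟨l, hl, hl2⟩ := exists_place s.1 hs.1 v
  refine ⟨⟨s.1.1, v, l, l', hl, ?_⟩, mem_cell.2 ⟨rfl, hl', hl2, fun w _ => hs.1 w⟩⟩
  rintro ⟨u, f, f'⟩ ht
  refine hs.2 v u f f' ?_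
  rw [hl', Option.mem_def.1 ht]
  rfl

theorem stateSpace_eq : stateSpace N K = ⋃ τ : Graft N K, τ.cell :=
  Subset.antisymm (fun _ hs => mem_iUnion.2 (exists_mem_cell hs)) (iUnion_subset cell_subset)

/-- A contact parameter records the two faces but not the parent, which is why the parents are
compared separately. -/
theorem eq_of_mem_placeSet {l l' : Place N K} {a : Param K} (h : a ∈ placeSet l)
    (h' : a ∈ placeSet l') (hl : l.map Prod.fst = l'.map Prod.fst) : l = l' := by
  rcases l with _ | ⟨u, f, f'⟩ <;> rcases l' with _ | ⟨u', g, g'⟩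
  · rfl
  · simp at hl
  · simp at hl
  · obtain ⟨y, rfl⟩ := h
    obtain ⟨z, hz⟩ := h'
    simp only [Sum.inr.injEq, Prod.mk.injEq] at hz
    simp only [Option.map_some, Option.some.injEq] at hl
    rw [hl, hz.1, hz.2.1]

/-- The auxiliary variable gives the object and the target; the tree and the present parameter of
the object give the source. -/
theorem eq_of_mem_cell {τ τ' : Graft N K} {s : Latent N K × Aux N K} (h : s ∈ τ.cell)
    (h' : s ∈ τ'.cell) : τ = τ' := by
  obtain ⟨h1, h2, h3, -⟩ := mem_cell.1 h
  obtain ⟨k1, k2, k3, -⟩ := mem_cell.1 h'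
  have ht : τ.tree = τ'.tree := h1.symm.trans k1
  obtain ⟨hv, hl⟩ := placeAux_injective (h2.symm.trans k2)
  refine ext_data ht hv (eq_of_mem_placeSet h3 (hv ▸ k3) ?_) hl
  rw [← τ.par_obj, ← τ'.par_obj, ht, hv]

theorem pairwise_disjoint_cell : Pairwise (Function.onFun Disjoint (cell : Graft N K → _)) :=
  fun _ _ hne => Set.disjoint_left.2 fun _ h h' => hne (eq_of_mem_cell h h')

theorem measurableSet_paramSet (τ : Graft N K) (w : Fin N) : MeasurableSet (τ.paramSet w) := by
  unfold paramSet
  split_ifs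
  · exact measurableSet_placeSet _
  · have e : (Sum.isLeft : Param K → Bool) = Sum.elim (fun _ => true) fun _ => false := by
      funext a
      cases a <;> rfl
    have hm : Measurable (Sum.isLeft : Param K → Bool) := by
      rw [e]
      exact measurable_const.sumElim measurable_const
    exact hm (MeasurableSet.of_discrete (s := {b : Bool | b = true ↔ τ.tree.par w = none}))

theorem measurableSet_cell (τ : Graft N K) : MeasurableSet τ.cell :=
  ((MeasurableSet.of_discrete).prod
    (MeasurableSet.univ_pi τ.measurableSet_paramSet)).prod (measurableSet_singleton _)

/-! ### The move on a cell -/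

variable (face : Fin N → Fin K → SE3)

/-- The new parameter of the moved object. -/
noncomputable def newParam (τ : Graft N K) (θ : Fin N → Param K) : Param K :=
  ofPose face (absPose face (τ.tree, θ)) τ.obj τ.tgt
    (toPose face (absPose face (τ.tree, θ)) τ.obj τ.src (θ τ.obj))

/-- The move, as a function of the parameters. -/
noncomputable def newState (τ : Graft N K) (θ : Fin N → Param K) : Latent N K × Aux N K :=
  ((τ.rev.tree, Function.update θ τ.obj (τ.newParam face θ)), placeAux τ.obj τ.src)

theorem absPose_eq_toPose {x : Latent N K} {v : Fin N} {l : Place N K}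
    (hp : x.1.par v = l.map Prod.fst) (ha : x.2 v ∈ placeSet l) :
    absPose face x v = toPose face (absPose face x) v l (x.2 v) := by
  rcases l with _ | ⟨u, f, f'⟩
  · rw [absPose_eq_of_par_eq_none face hp]
    rfl
  · rw [absPose_eq_of_par_eq_some face (u := u) hp]
    obtain ⟨y, hy⟩ := ha
    rw [← hy]
    rfl

theorem move_eq {τ : Graft N K} {s : Latent N K × Aux N K} (hs : s ∈ τ.cell) :
    move face s = τ.newState face s.1.2 := by
  obtain ⟨⟨G, θ⟩, y⟩ := s
  obtain ⟨h1, h2, h3, -⟩ := mem_cell.1 hs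
  simp only at h1 h2 h3
  have hpose := absPose_eq_toPose face (x := (τ.tree, θ)) τ.par_obj h3
  have hp := τ.par_obj
  subst h1 h2
  rw [newState, newParam, ← hpose]
  change _ = ((τ.tree.regraft τ.obj (τ.tgt.map Prod.fst), _), _)
  rcases hsrc : τ.src with _ | ⟨u', f₂, f₂'⟩ <;> rcases htgt : τ.tgt with _ | ⟨u, f, f'⟩ <;>
    rw [hsrc] at h3 hp <;> obtain ⟨p, hθ⟩ := h3 <;> simp only [Option.map] at hp
  -- Floating to floating: regrafting and updating both reproduce the old data, in accordance with
  -- `move` leaving such a state unchanged.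
  · have h4 : τ.tree.regraft τ.obj none = τ.tree := by
      refine RootedTree.ext_par ?_
      rw [τ.tree.regraft_par _ (by simp), ← hp, Function.update_eq_self]
    have h5 : Function.update θ τ.obj (ofPose face (absPose face (τ.tree, θ)) τ.obj none
        (absPose face (τ.tree, θ) τ.obj)) = θ := by
      have h6 : absPose face (τ.tree, θ) τ.obj = p := by
        rw [absPose_eq_of_par_eq_none face hp]
        change Sum.elim _ _ (θ τ.obj) = p
        rw [← hθ]
        rfl
      rw [h6]
      exact (congrArg _ hθ).trans (Function.update_eq_self _ _)
    simp only [Option.map, h4, h5]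
    simp only [move, placeAux, hp, ← hθ]
  · simp only [move, placeAux, hp, ← hθ]
    rfl
  · simp only [move, placeAux, hp, ← hθ]
    rfl
  · simp only [move, placeAux, hp, ← hθ]
    rfl

theorem measurable_newParam (τ : Graft N K) : Measurable (τ.newParam face) :=
  measurable_ofPose face (measurable_absPose face τ.tree) _ _
    (measurable_toPose face (measurable_absPose face τ.tree) _ _ (measurable_pi_apply _))

theorem measurable_newState (τ : Graft N K) : Measurable (τ.newState face) :=
  (measurable_const.prodMk (measurable_update'.comp
    (measurable_id.prodMk (τ.measurable_newParam face)))).prodMk measurable_const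

theorem restrict_cell (m₀ m₂ m₁ : ℝ) (τ : Graft N K) :
    (((Measure.count : Measure (RootedTree N)).prod
      (Measure.pi fun _ : Fin N => paramMeasure K m₀ m₂ m₁)).prod Measure.count).restrict τ.cell =
    (Measure.pi fun w => (paramMeasure K m₀ m₂ m₁).restrict (τ.paramSet w)).map
      (fun θ => ((τ.tree, θ), placeAux τ.obj τ.tgt)) := by
  rw [cell, ← Measure.prod_restrict, ← Measure.prod_restrict, Measure.restrict_pi_pi,
    count_restrict_singleton, count_restrict_singleton, Measure.dirac_prod, Measure.prod_dirac,
    Measure.map_map measurable_prodMk_right measurable_prodMk_left]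
  rfl

variable {m₀ m₂ m₁ : ℝ}

/-- `pi_map_update` applies with the allowed parameter sets before and after the move; these differ
only at the moved object. -/
theorem map_pi_newParam (h₀ : 0 < m₀) (h₂ : 0 < m₂) (h₁ : 0 < m₁) (τ : Graft N K) :
    (Measure.pi fun w => (paramMeasure K m₀ m₂ m₁).restrict (τ.paramSet w)).map
      (fun θ => Function.update θ τ.obj (τ.newParam face θ)) =
    (placeMass m₀ m₂ m₁ τ.src * placeMassInv m₀ m₂ m₁ τ.tgt) •
      Measure.pi fun w => (paramMeasure K m₀ m₂ m₁).restrict (τ.rev.paramSet w) := by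
  refine pi_map_update _ _ (fun w hw => ?_) (τ.measurable_newParam face) fun θ => ?_
  · have : τ.rev.paramSet w = τ.paramSet w := by
      have hw' : ¬ w = τ.rev.obj := hw
      rw [paramSet, paramSet, if_neg hw, if_neg hw', rev_tree_par, Function.update_of_ne hw]
    rw [this]
  · have e : (fun a => τ.newParam face (Function.update θ τ.obj a)) = fun a =>
        ofPose face (absPose face (τ.tree, θ)) τ.obj τ.tgt
          (toPose face (absPose face (τ.tree, θ)) τ.obj τ.src a) := by
      funext a
      -- Only the poses of the old and the new parent enter, and both lie outside the subtree, so
      -- they are constants while `a` varies.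
      have hP : ∀ u, ¬ τ.tree.InSubtree τ.obj u →
          absPose face (τ.tree, Function.update θ τ.obj a) u = absPose face (τ.tree, θ) u :=
        fun u hu => absPose_congr face (x := (τ.tree, θ))
          (x' := (τ.tree, Function.update θ τ.obj a)) (fun _ _ => rfl)
          (fun w hw => Function.update_of_ne hw a θ) u hu
      rw [newParam, Function.update_self,
        toPose_congr face fun t ht => hP t.1 (τ.not_inSubtree_src t ht),
        ofPose_congr face fun t ht => hP t.1 (τ.not_inSubtree t ht)]
    have e1 : τ.paramSet τ.obj = placeSet τ.src := if_pos rfl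
    have e2 : τ.rev.paramSet τ.obj = placeSet τ.tgt := if_pos rfl
    rw [e, e1, e2]
    exact map_ofPose_toPose face h₀ h₂ h₁ _ _ _ _

theorem aemeasurable_move_cell (τ : Graft N K) (ν : Measure (Latent N K × Aux N K)) :
    AEMeasurable (move face) (ν.restrict τ.cell) :=
  ⟨fun s => τ.newState face s.1.2,
    (τ.measurable_newState face).comp (measurable_snd.comp measurable_fst),
    (ae_restrict_mem τ.measurableSet_cell).mono fun _ hs => move_eq face hs⟩

theorem map_move_cell (h₀ : 0 < m₀) (h₂ : 0 < m₂) (h₁ : 0 < m₁) (τ : Graft N K) :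
    ((((Measure.count : Measure (RootedTree N)).prod
      (Measure.pi fun _ : Fin N => paramMeasure K m₀ m₂ m₁)).prod Measure.count).restrict
        τ.cell).map (move face) =
    (placeMass m₀ m₂ m₁ τ.src * placeMassInv m₀ m₂ m₁ τ.tgt) •
      (((Measure.count : Measure (RootedTree N)).prod
        (Measure.pi fun _ : Fin N => paramMeasure K m₀ m₂ m₁)).prod Measure.count).restrict
          τ.rev.cell := by
  have hm : Measurable fun s : Latent N K × Aux N K => τ.newState face s.1.2 :=
    (τ.measurable_newState face).comp (measurable_snd.comp measurable_fst)
  have hmk : ∀ (G : RootedTree N) (y : Aux N K),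
      Measurable fun θ : Fin N → Param K => (((G, θ), y) : Latent N K × Aux N K) := fun G y =>
    (measurable_const.prodMk measurable_id).prodMk measurable_const
  have hU : Measurable fun θ : Fin N → Param K =>
      Function.update θ τ.obj (τ.newParam face θ) :=
    measurable_update'.comp (measurable_id.prodMk (τ.measurable_newParam face))
  rw [Measure.map_congr ((ae_restrict_mem τ.measurableSet_cell).mono fun s hs => move_eq face hs),
    restrict_cell, Measure.map_map hm (hmk _ _), restrict_cell, ← Measure.map_smul,
    ← τ.map_pi_newParam face h₀ h₂ h₁, Measure.map_map (hmk _ _) hU]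
  rfl

/-! ### The density of the move -/

/-- The density on a cell of the image of the base measure. -/
noncomputable def weight (m₀ m₂ m₁ : ℝ) (τ : Graft N K) : ℝ≥0∞ :=
  placeMass m₀ m₂ m₁ τ.tgt * placeMassInv m₀ m₂ m₁ τ.src

/-- The density of the image of the base measure under the move. -/
noncomputable def density (N K : ℕ) (m₀ m₂ m₁ : ℝ) (s : Latent N K × Aux N K) : ℝ≥0∞ :=
  ∑' τ : Graft N K, τ.cell.indicator (fun _ => τ.weight m₀ m₂ m₁) s

theorem measurable_density : Measurable (density N K m₀ m₂ m₁) :=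
  Measurable.tsum fun τ => measurable_const.indicator τ.measurableSet_cell

theorem density_eq {τ : Graft N K} {s : Latent N K × Aux N K} (hs : s ∈ τ.cell) :
    density N K m₀ m₂ m₁ s = τ.weight m₀ m₂ m₁ := by
  rw [density, tsum_eq_single τ fun τ' hne => indicator_of_notMem
    (fun h => hne (eq_of_mem_cell h hs)) _, indicator_of_mem hs]

theorem stateMeasure_eq_sum : stateMeasure N K m₀ m₂ m₁ =
    Measure.sum fun τ : Graft N K => (((Measure.count : Measure (RootedTree N)).prod
      (Measure.pi fun _ : Fin N => paramMeasure K m₀ m₂ m₁)).prod Measure.count).restrict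
        τ.cell := by
  rw [stateMeasure, stateSpace_eq,
    Measure.restrict_iUnion pairwise_disjoint_cell fun τ => τ.measurableSet_cell]

theorem aemeasurable_move : AEMeasurable (move face) (stateMeasure N K m₀ m₂ m₁) := by
  rw [stateMeasure, stateSpace_eq, aemeasurable_iUnion_iff]
  exact fun τ => τ.aemeasurable_move_cell face _

/-- The part of the image lying on the cell of `τ` comes from the cell of `τ.rev`. The factor of
`map_move_cell` for `τ.rev` has source and target exchanged, which is exactly `weight`. -/
theorem map_move (h₀ : 0 < m₀) (h₂ : 0 < m₂) (h₁ : 0 < m₁) :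
    (stateMeasure N K m₀ m₂ m₁).map (move face) =
      (stateMeasure N K m₀ m₂ m₁).withDensity (density N K m₀ m₂ m₁) := by
  have ha := aemeasurable_move face (m₀ := m₀) (m₂ := m₂) (m₁ := m₁)
  rw [stateMeasure_eq_sum] at ha ⊢
  rw [Measure.map_sum ha, withDensity_sum]
  refine Measure.ext fun E hE => ?_
  -- Reindexing by reversal aligns the two sums according to the cell where the mass arrives.
  rw [Measure.sum_apply _ hE, Measure.sum_apply _ hE, ← revEquiv.tsum_eq]
  refine tsum_congr fun τ => ?_
  have h1 := (revEquiv τ).map_move_cell face h₀ h₂ h₁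
  have h2 : density N K m₀ m₂ m₁ =ᵐ[((((Measure.count : Measure (RootedTree N)).prod
      (Measure.pi fun _ : Fin N => paramMeasure K m₀ m₂ m₁)).prod Measure.count).restrict
        τ.cell)] fun _ => τ.weight m₀ m₂ m₁ :=
    (ae_restrict_mem τ.measurableSet_cell).mono fun s hs => density_eq hs
  have h3 : (revEquiv τ).rev = τ := τ.rev_rev
  rw [h3] at h1
  rw [h1, withDensity_congr_ae h2, withDensity_const]
  rfl

instance : SigmaFinite (stateMeasure N K m₀ m₂ m₁) := by
  unfold stateMeasure; infer_instance

theorem rnDeriv_move (h₀ : 0 < m₀) (h₂ : 0 < m₂) (h₁ : 0 < m₁) :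
    (stateMeasure N K m₀ m₂ m₁).map (move face) ≪ stateMeasure N K m₀ m₂ m₁ ∧
      ∀ᵐ s ∂(stateMeasure N K m₀ m₂ m₁), ((stateMeasure N K m₀ m₂ m₁).map (move face)).rnDeriv
        (stateMeasure N K m₀ m₂ m₁) s = density N K m₀ m₂ m₁ s :=
  rnDeriv_of_map_eq_withDensity measurable_density (map_move face h₀ h₂ h₁)

/-! ### The four kinds of moves -/

theorem density_floatingToFloating {s : Latent N K × Aux N K} (hs : s ∈ floatingToFloating N K) :
    density N K m₀ m₂ m₁ s = 1 := by
  obtain ⟨hs, v, hv, hp⟩ := hs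
  obtain ⟨τ, hτ⟩ := exists_mem_cell hs
  obtain ⟨h1, h2, -, -⟩ := mem_cell.1 hτ
  obtain ⟨rfl, ht⟩ := placeAux_injective (l' := none) (h2.symm.trans hv)
  have h3 : τ.src = none := by
    have := τ.par_obj
    rw [← h1, hp] at this
    simpa using this.symm
  rw [density_eq hτ, weight, ht, h3, placeMass, placeMassInv, one_mul]

theorem density_contactToFloating {s : Latent N K × Aux N K} (hs : s ∈ contactToFloating N K) :
    density N K m₀ m₂ m₁ s = ENNReal.ofReal (m₀ / (m₂ * m₁)) := by
  obtain ⟨hs, v, hv, hp⟩ := hs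
  obtain ⟨τ, hτ⟩ := exists_mem_cell hs
  obtain ⟨h1, h2, -, -⟩ := mem_cell.1 hτ
  obtain ⟨rfl, ht⟩ := placeAux_injective (l' := none) (h2.symm.trans hv)
  rw [density_eq hτ, weight, ht]
  rcases h3 : τ.src with _ | t
  · rw [h1, τ.par_obj, h3] at hp
    exact absurd rfl hp
  · rw [placeMass, placeMassInv, one_mul]

theorem density_floatingToContact {s : Latent N K × Aux N K} (hs : s ∈ floatingToContact N K) :
    density N K m₀ m₂ m₁ s = ENNReal.ofReal (m₂ * m₁ / m₀) := by
  obtain ⟨hs, v, u, f, f', hv, hp⟩ := hs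
  obtain ⟨τ, hτ⟩ := exists_mem_cell hs
  obtain ⟨h1, h2, -, -⟩ := mem_cell.1 hτ
  obtain ⟨rfl, ht⟩ := placeAux_injective (l' := some (u, f, f')) (h2.symm.trans hv)
  have h3 : τ.src = none := by
    have := τ.par_obj
    rw [← h1, hp] at this
    simpa using this.symm
  rw [density_eq hτ, weight, ht, h3, placeMass, placeMassInv, mul_one]

theorem density_contactToContact (h₀ : 0 < m₀) (h₂ : 0 < m₂) (h₁ : 0 < m₁)
    {s : Latent N K × Aux N K} (hs : s ∈ contactToContact N K) :
    density N K m₀ m₂ m₁ s = 1 := by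
  obtain ⟨hs, v, u, f, f', hv, hp⟩ := hs
  obtain ⟨τ, hτ⟩ := exists_mem_cell hs
  obtain ⟨h1, h2, -, -⟩ := mem_cell.1 hτ
  obtain ⟨rfl, ht⟩ := placeAux_injective (l' := some (u, f, f')) (h2.symm.trans hv)
  rw [density_eq hτ, weight, ht]
  rcases h3 : τ.src with _ | t
  · rw [h1, τ.par_obj, h3] at hp
    exact absurd rfl hp
  · rw [placeMass, placeMassInv]
    -- Leaving one contact and entering another contribute reciprocal factors.
    exact ofReal_div_mul_ofReal_div (by positivity) h₀

end Graft

/-! ### Acceptance probabilities. -/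

theorem move_of_floatingToFloating {N K : ℕ} (face : Fin N → Fin K → SE3)
    {s : Latent N K × Aux N K} (hs : s ∈ floatingToFloating N K) : move face s = s := by
  obtain ⟨-, v, hv, hp⟩ := hs
  simp only [move, hv, hp]

/-- The constant tree prior `c⁻¹` cancels. The splitting into separate ratios holds without
positivity, also for vanishing denominators, where division gives `0`. -/
theorem acceptProb_eq {X Y : Type*} [MeasurableSpace X] [MeasurableSpace Y] (μ : Measure (X × Y))
    (h : X × Y → X × Y) {prior lik p : X → ℝ} (q : X → Y → ℝ) {c : ℝ} (hc : c ≠ 0)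
    (hp : ∀ x, p x = c⁻¹ * prior x * lik x) (s : X × Y) :
    acceptProb μ h p q s = min 1 (lik (h s).1 / lik s.1 * (prior (h s).1 / prior s.1) *
      (q (h s).1 (h s).2 / q s.1 s.2) * ((μ.map h).rnDeriv μ s).toReal) := by
  rw [acceptProb, hp, hp]
  congr 2
  rw [mul_assoc c⁻¹, mul_assoc c⁻¹, mul_assoc c⁻¹, mul_assoc c⁻¹,
    mul_div_mul_left _ _ (inv_ne_zero hc), mul_div_mul_comm, mul_div_mul_comm,
    mul_comm (prior (h s).1 / prior s.1)]

theorem acceptProb_of_fixed {X Y : Type*} [MeasurableSpace X] [MeasurableSpace Y]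
    (μ : Measure (X × Y)) {h : X × Y → X × Y} {p : X → ℝ} {q : X → Y → ℝ} {s : X × Y}
    (hs : h s = s) (hpos : 0 < p s.1 * q s.1 s.2) (hd : (μ.map h).rnDeriv μ s = 1) :
    acceptProb μ h p q s = 1 := by
  rw [acceptProb, hs, hd, div_self hpos.ne']
  simp

end ScenePose

theorem mainTheorem4 :
    -- the chosen quaternion over `η` is the unique closest one to the identity in `S³`
    (∀ η : S2, η ≠ south → poleImage (spin (hopfQuat η)) = η ∧
      ∀ q : S3, poleImage (spin q) = η → q ≠ hopfQuat η →
        InnerProductGeometry.angle (1 : ℍ[ℝ]) (hopfQuat η) <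
          InnerProductGeometry.angle (1 : ℍ[ℝ]) q) ∧
    -- the Hopf coordinates of `spin (w, x, y, z)`
    (∀ (q : S3) (w x y z : ℝ), (q : ℍ[ℝ]) = quat w x y z → spin q ∈ rotDomain →
      ((hopfCoord (spin q)).1 : E3) =
        !₂[2 * (x * z + w * y), 2 * (y * z - w * x), 1 - 2 * (x ^ 2 + y ^ 2)] ∧
      ((hopfCoord (spin q)).2 : ℂ) =
        Complex.exp (((2 * arctanQuot z w : ℝ) : ℂ) * Complex.I)) ∧
    -- the rotation with given Hopf coordinates
    (∀ (η : S2) (φ : S1) (a b c t : ℝ), η ≠ south → (η : E3) = !₂[a, b, c] →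
      (φ : ℂ) = Complex.exp ((t : ℂ) * Complex.I) →
      ∃ q : S3, hopfRot (η, φ) = spin q ∧
        (q : ℍ[ℝ]) = (1 / √(2 * (1 + c))) •
          quat ((1 + c) * Real.cos (t / 2))
            (a * Real.sin (t / 2) - b * Real.cos (t / 2))
            (a * Real.cos (t / 2) + b * Real.sin (t / 2))
            ((1 + c) * Real.sin (t / 2))) ∧
    -- the diffeomorphisms
    IsDiffeoOnVia embRot embHopf hopfCoord hopfRot rotDomain hopfDomain ∧
    IsDiffeoOnVia embRot embHopf hopfCoord hopfRot rotStar hopfStar ∧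
    IsDiffeoOnVia embPose embContact xi xiInv poseDomain contactDomain ∧
    -- absolute continuity and constancy of the densities, for all total masses
    (∀ m₀ m₂ m₁ : ℝ, 0 < m₀ → 0 < m₂ → 0 < m₁ →
      haarSO3 m₀ rotDomainᶜ = 0 ∧ hopfMeasure m₂ m₁ hopfDomainᶜ = 0 ∧
      haarSO3 m₀ rotStarᶜ = 0 ∧ hopfMeasure m₂ m₁ hopfStarᶜ = 0 ∧
      baseMeasure m₀ m₂ m₁ ellDomainᶜ = 0 ∧
      (AEMeasurable ellStar (baseMeasureStar m₀ m₂ m₁) ∧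
        (baseMeasureStar m₀ m₂ m₁).map ellStar ≪ baseMeasureStar m₀ m₂ m₁ ∧
        ∀ᵐ s ∂(baseMeasureStar m₀ m₂ m₁),
          ((baseMeasureStar m₀ m₂ m₁).map ellStar).rnDeriv (baseMeasureStar m₀ m₂ m₁) s =
            Sum.elim (fun _ => ENNReal.ofReal (m₂ * m₁ / m₀))
              (fun _ => ENNReal.ofReal (m₀ / (m₂ * m₁))) s) ∧
      (AEMeasurable ell (baseMeasure m₀ m₂ m₁) ∧
        (baseMeasure m₀ m₂ m₁).map ell ≪ baseMeasure m₀ m₂ m₁ ∧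
        ∀ᵐ s ∂(baseMeasure m₀ m₂ m₁),
          ((baseMeasure m₀ m₂ m₁).map ell).rnDeriv (baseMeasure m₀ m₂ m₁) s =
            Sum.elim (fun _ => ENNReal.ofReal (m₂ * m₁ / m₀))
              (fun _ => ENNReal.ofReal (m₀ / (m₂ * m₁))) s) ∧
      ∀ g₁ g₂ : SE3, AEMeasurable (ellAbs g₁ g₂) (baseMeasure m₀ m₂ m₁) ∧
        (baseMeasure m₀ m₂ m₁).map (ellAbs g₁ g₂) ≪ baseMeasure m₀ m₂ m₁ ∧
        ∀ᵐ s ∂(baseMeasure m₀ m₂ m₁),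
          ((baseMeasure m₀ m₂ m₁).map (ellAbs g₁ g₂)).rnDeriv (baseMeasure m₀ m₂ m₁) s =
            Sum.elim (fun _ => ENNReal.ofReal (m₂ * m₁ / m₀))
              (fun _ => ENNReal.ofReal (m₀ / (m₂ * m₁))) s) ∧
    -- the values for the masses `π²`, `4π`, `2π`
    (∀ᵐ s ∂(baseMeasure (Real.pi ^ 2) (4 * Real.pi) (2 * Real.pi)),
      ((baseMeasure (Real.pi ^ 2) (4 * Real.pi) (2 * Real.pi)).map ell).rnDeriv
        (baseMeasure (Real.pi ^ 2) (4 * Real.pi) (2 * Real.pi)) s =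
          Sum.elim (fun _ => (8 : ℝ≥0∞)) (fun _ => (1 / 8 : ℝ≥0∞)) s) ∧
    -- the corrections and acceptance probabilities of the moves on scene graphs
    ∀ (N K : ℕ) (face : Fin N → Fin K → SE3) (μ : Measure (Latent N K × Aux N K)),
      μ = stateMeasure N K (Real.pi ^ 2) (4 * Real.pi) (2 * Real.pi) →
      AEMeasurable (move face) μ ∧ μ.map (move face) ≪ μ ∧
      (∀ᵐ s ∂μ,
        (s ∈ floatingToFloating N K → (μ.map (move face)).rnDeriv μ s = 1) ∧
        (s ∈ floatingToContact N K → (μ.map (move face)).rnDeriv μ s = 8) ∧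
        (s ∈ contactToFloating N K → (μ.map (move face)).rnDeriv μ s = 1 / 8) ∧
        (s ∈ contactToContact N K → (μ.map (move face)).rnDeriv μ s = 1)) ∧
      ∀ (prior lik p : Latent N K → ℝ) (q : Latent N K → Aux N K → ℝ),
        (∀ x, p x = ((N + 1 : ℝ) ^ (N - 1))⁻¹ * prior x * lik x) →
        ∀ᵐ s ∂μ, 0 < p s.1 * q s.1 s.2 →
          (s ∈ floatingToFloating N K → acceptProb μ (move face) p q s = 1) ∧
          (s ∈ floatingToContact N K → acceptProb μ (move face) p q s =
            min 1 (lik (move face s).1 / lik s.1 * (prior (move face s).1 / prior s.1) *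
              (q (move face s).1 (move face s).2 / q s.1 s.2) * 8)) ∧
          (s ∈ contactToFloating N K → acceptProb μ (move face) p q s =
            min 1 (lik (move face s).1 / lik s.1 * (prior (move face s).1 / prior s.1) *
              (q (move face s).1 (move face s).2 / q s.1 s.2) * (1 / 8))) ∧
          (s ∈ contactToContact N K → acceptProb μ (move face) p q s =
            min 1 (lik (move face s).1 / lik s.1 * (prior (move face s).1 / prior s.1) *
              (q (move face s).1 (move face s).2 / q s.1 s.2))) := by
  refine ⟨fun η hη => ⟨?_, fun q hq hne => angle_hopfQuat_lt hη hq hne⟩,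
    fun q w x y z hq h => hopfCoord_spin hq h,
    fun η φ a b c t hη he hφ => exists_hopfRot_eq_spin hη he hφ,
    isDiffeoOnVia_hopfCoord, isDiffeoOnVia_hopfCoord_star, isDiffeoOnVia_xi,
    fun m₀ m₂ m₁ h₀ h₂ h₁ => ⟨haarSO3_rotDomain_compl h₀, hopfMeasure_hopfDomain_compl m₂ m₁,
      ae_mem_rotStar h₀, ae_mem_hopfStar m₂ m₁, baseMeasure_ellDomain_compl m₂ m₁ h₀,
      density_ellStar h₀ h₂ h₁, density_ell h₀ h₂ h₁, density_ellAbs h₀ h₂ h₁⟩, ?_, ?_⟩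
  · rw [← hopfRot_one]
    exact poleImage_hopfRot hη 1
  · have h := (density_ell (m₀ := Real.pi ^ 2) (m₂ := 4 * Real.pi) (m₁ := 2 * Real.pi)
      (by positivity) (by positivity) (by positivity)).2.2
    simpa only [ofReal_mass_ratio, ofReal_mass_ratio_inv] using h
  · rintro N K face μ rfl
    have h₀ : 0 < Real.pi ^ 2 := by positivity
    have h₂ : 0 < 4 * Real.pi := by positivity
    have h₁ : 0 < 2 * Real.pi := by positivity
    obtain ⟨hac, hd⟩ := Graft.rnDeriv_move (N := N) (K := K) face h₀ h₂ h₁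
    refine ⟨Graft.aemeasurable_move face, hac, ?_, fun prior lik p q hp => ?_⟩
    · filter_upwards [hd] with s hs
      rw [hs]
      refine ⟨fun h => Graft.density_floatingToFloating h, fun h => ?_, fun h => ?_,
        fun h => Graft.density_contactToContact h₀ h₂ h₁ h⟩
      · rw [Graft.density_floatingToContact h, ofReal_mass_ratio]
      · rw [Graft.density_contactToFloating h, ofReal_mass_ratio_inv]
    -- The exponent is truncated at `N = 0`; only the nonvanishing of the power matters.
    · have hc : ((N + 1 : ℝ) ^ (N - 1)) ≠ 0 := by positivity
      filter_upwards [hd] with s hs hpos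
      refine ⟨fun h => ?_, fun h => ?_, fun h => ?_, fun h => ?_⟩
      · exact acceptProb_of_fixed _ (move_of_floatingToFloating face h) hpos
          (hs.trans (Graft.density_floatingToFloating h))
      · rw [acceptProb_eq _ _ q hc hp, hs, Graft.density_floatingToContact h, ofReal_mass_ratio]
        rfl
      · rw [acceptProb_eq _ _ q hc hp, hs, Graft.density_contactToFloating h,
          ofReal_mass_ratio_inv]
        simp
      · rw [acceptProb_eq _ _ q hc hp, hs, Graft.density_contactToContact h₀ h₂ h₁ h,
          ENNReal.toReal_one, mul_one]
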